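/- Let $d\ge 0$, $t\ge 0$, and let $A:[0,t]\to\mathbb R^{d\times d}$ be Lebesgue integrable. Let $Y$ be the fundamental solution of $Y'=A(\tau)Y$, $Y(0)=I$, on $[0,t]$, i.e. the absolutely continuous matrix function with $Y(0)=I$ that satisfies $Y'(\tau)=A(\tau)Y(\tau)$ for almost every $\tau\in[0,t]$. The Magnus series $\sum_{n\ge1}\Omega_n$ of $A$ is obtained from the equation $\Omega'=\sum_{k\ge0}\frac{B_k}{k!}\operatorname{ad}_\Omega^k(A)$, $\Omega(0)=0$, by collecting the terms that are of the same degree in $A$; here $\operatorname{ad}_X(Z)=XZ-ZX$ and $B_k$ are the Bernoulli numbers with $B_1=-\tfrac12$. Explicitly, $\Omega_1(s)=\int_0^s A(\tau)\,d\tau$ and, for $n\ge 1$, $$\Omega_{n+1}(s)=\int_0^s\sum_{k=1}^{n}\frac{B_k}{k!}\sum_{\substack{m_1+\dots+m_k=n\\ m_1,\dots,m_k\ge1}}\operatorname{ad}_{\Omega_{m_1}(\tau)}\cdots\operatorname{ad}_{\Omega_{m_k}(\tau)}\bigl(A(\tau)\bigr)\,d\tau .$$ Let $\|\cdot\|_2$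 denote the spectral norm of a matrix (the operator norm induced by the Euclidean norm). If $$\int_0^t\|A(\tau)\|_2\,d\tau<\pi,$$ then the Magnus series $\sum_{n=1}^\infty\Omega_n(t)$ converges (absolutely), and its sum $\Omega(t)$ satisfies $e^{\Omega(t)}=Y(t)$. -/

import Mathlib

open scoped Matrix.Norms.L2Operator

/-- `Y` is the fundamental solution on `[0, t]` of `Y' = A(τ) Y`, `Y(0) = I`, for an integrable
coefficient matrix `A` (solution in the sense of Carathéodory): `Y` is absolutely continuous on
`[0, t]`, the differential equation holds at almost every point, and `Y(0) = I`. -/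
structure IsFundamentalSolution {ι : Type*} [Fintype ι] [DecidableEq ι]
    (A Y : ℝ → Matrix ι ι ℝ) (t : ℝ) : Prop where
  absolutelyContinuous : AbsolutelyContinuousOnInterval Y 0 t
  initial : Y 0 = 1
  ode : ∀ᵐ τ : ℝ, τ ∈ Set.Ioo 0 t → HasDerivAt Y (A τ * Y τ) τ

/-- The coefficient of `κ ^ n` in `ad_W ^ k (a)`, where `W = ∑ m, κ ^ m • W m` is a formal power
series in `κ` with matrix coefficients and `ad_W (X) = ⁅W, X⁆ = W * X - X * W`, that is,
`∑ ⁅W m₁, ⁅W m₂, … ⁅W mₖ, a⁆ … ⁆⁆` over all `m₁ + ⋯ + mₖ = n`. -/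
def adPowCoeff {ι : Type*} [Fintype ι]
    (W : ℕ → Matrix ι ι ℝ) (a : Matrix ι ι ℝ) : ℕ → ℕ → Matrix ι ι ℝ
  | 0, n => if n = 0 then a else 0
  | k + 1, n => ∑ p ∈ Finset.HasAntidiagonal.antidiagonal n,
      (W p.1 * adPowCoeff W a k p.2 - adPowCoeff W a k p.2 * W p.1)

/-- The terms `Ω_n` of the Magnus series of `A`. The formal solution
`Ω(t; κ) = ∑_{n ≥ 1} κ ^ n Ω_n(t)` of the equation `Ω' = ∑ₖ (Bₖ / k!) ad_Ω ^ k (κ A(t))`,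
`Ω(0) = 0` (with `B₁ = -1/2`) is given, on comparing the coefficients of `κ ^ (n + 1)`, by
`Ω_{n+1}(t) = ∫₀ᵗ ∑ₖ (Bₖ / k!) [κ ^ n] ad_{Ω(s; κ)} ^ k (A(s)) ds`.
As `Ω_0 = 0`, only `k ≤ n` contributes, and only `Ω_m` with `m ≤ n` enters; the `if` below just
makes the latter visible to the recursion. -/
noncomputable def magnusTerm {ι : Type*} [Fintype ι] [DecidableEq ι]
    (A : ℝ → Matrix ι ι ℝ) : ℕ → ℝ → Matrix ι ι ℝ
  | 0 => fun _ => 0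
  | n + 1 => fun t => ∫ s in (0 : ℝ)..t, ∑ k ∈ Finset.range (n + 1),
      ((bernoulli k : ℝ) / (k.factorial : ℝ)) •
        adPowCoeff (fun m => if _h : m ≤ n then magnusTerm A m s else 0) (A s) k n

/-! For complex `z` let `Y_z` solve `Y' = z A Y`, `Y(0) = 1`. Its Dyson series of iterated integrals
shows that `Y_z(t)` is entire in `z`. The Magnus series is the formal logarithm of that series, so
it is enough to find a holomorphic logarithm of `Y_z(t)` on a disc of radius greater than 1: its
Taylor series at 0 converges absolutely at `z = 1`.

The constant π enters through an angle. An orbit satisfies `‖y'‖ ≤ |z| ‖A‖ ‖y‖`, so in the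
underlying real inner product space its direction turns by at most `|z| ∫ ‖A‖`. Below π it cannot
reach the direction opposite to its start (`HasACDeriv.ne_neg_smul`). Hence `Y_z(t)` has no
eigenvalue in `(-∞, 0]`, that is, `1 + u (Y_z(t) - 1)` is invertible for all `u ∈ [0, 1]`
(`isUnit_segment_dysonSum`). Integrating along this segment gives a logarithm that is holomorphic in
`z` (`exp_segmentLog`, `differentiableOn_segmentLog`).

That the Taylor coefficients are the `Ω_n` is a formal matter. The derivative of `exp Ω` is `((e^ad
- 1)/ad)(Ω') exp Ω` with `ad = ad_Ω`, and the Bernoulli series inverts `(e^T - 1)/T`; so the Magnus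
recursion says that `exp Ω` satisfies the equation of the Dyson series, degree by degree
(`coeff_truncExp_magnusPowerSeries`). Near `z = 0` the truncated Magnus series and the holomorphic
logarithm thus have exponentials that agree up to `O(z^(N+1))`. As the derivative of `exp` at 0 is
the identity, they agree to that order themselves (`isBigO_sub_of_exp`). -/

section

open MeasureTheory Set Filter Topology

/-! ### Calculus of absolutely continuous functions with an almost everywhere derivative -/

section AbsolutelyContinuous

variable {E F G : Type*} [NormedAddCommGroup E] [NormedAddCommGroup F] [NormedAddCommGroup G]

theorem AbsolutelyContinuousOnInterval.of_dist_le {X Y : Type*} [PseudoMetricSpace X]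
    [PseudoMetricSpace Y] {f : ℝ → X} {g : ℝ → Y} {a b : ℝ} {K : ℝ}
    (hg : AbsolutelyContinuousOnInterval g a b)
    (h : ∀ x ∈ uIcc a b, ∀ y ∈ uIcc a b, dist (f x) (f y) ≤ K * dist (g x) (g y)) :
    AbsolutelyContinuousOnInterval f a b := by
  unfold AbsolutelyContinuousOnInterval at hg ⊢
  apply squeeze_zero' (Eventually.of_forall fun _ ↦ Finset.sum_nonneg fun _ _ ↦ dist_nonneg) ?_
    (by simpa using hg.const_mul K)
  rw [eventually_inf_principal]
  filter_upwards with E hE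
  rw [Finset.mul_sum]
  exact Finset.sum_le_sum fun i hi ↦ h _ (hE.1 i hi).1 _ (hE.1 i hi).2

/-- The primitive of an integrable vector-valued function is absolutely continuous. -/
theorem IntervalIntegrable.absolutelyContinuousOnInterval_integral [NormedSpace ℝ E]
    {f : ℝ → E} {a b : ℝ} (h : IntervalIntegrable f volume a b) :
    AbsolutelyContinuousOnInterval (fun x ↦ ∫ v in a..x, f v) a b := by
  have hn := h.norm.absolutelyContinuousOnInterval_intervalIntegral (left_mem_uIcc (a := a))
  refine hn.of_dist_le (K := 1) fun x hx y hy ↦ ?_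
  have hx' := h.mono_set (uIcc_subset_uIcc_left hx)
  have hy' := h.mono_set (uIcc_subset_uIcc_left hy)
  rw [dist_eq_norm, dist_eq_norm, one_mul, intervalIntegral.integral_interval_sub_left hx' hy',
    intervalIntegral.integral_interval_sub_left hx'.norm hy'.norm]
  exact intervalIntegral.norm_integral_le_abs_integral_norm

theorem AbsolutelyContinuousOnInterval.const (c : E) (a b : ℝ) :
    AbsolutelyContinuousOnInterval (fun _ ↦ c) a b := by
  unfold AbsolutelyContinuousOnInterval
  simpa using tendsto_const_nhds

theorem AbsolutelyContinuousOnInterval.normedRing_mul {A : Type*} [NormedRing A]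
    {f g : ℝ → A} {a b : ℝ} (hf : AbsolutelyContinuousOnInterval f a b)
    (hg : AbsolutelyContinuousOnInterval g a b) :
    AbsolutelyContinuousOnInterval (fun x ↦ f x * g x) a b := by
  obtain ⟨C, hC⟩ := hf.exists_bound
  obtain ⟨D, hD⟩ := hg.exists_bound
  unfold AbsolutelyContinuousOnInterval at hf hg ⊢
  apply squeeze_zero' (Eventually.of_forall fun _ ↦ Finset.sum_nonneg fun _ _ ↦ dist_nonneg) ?_
    (by simpa using (hg.const_mul C).add (hf.const_mul D))
  rw [eventually_inf_principal]
  filter_upwards with E hE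
  simp only [Finset.mul_sum, ← Finset.sum_add_distrib]
  refine Finset.sum_le_sum fun i hi ↦ ?_
  obtain ⟨h1, h2⟩ := hE.1 i hi
  have e : f (E.2 i).1 * g (E.2 i).1 - f (E.2 i).2 * g (E.2 i).2 =
      f (E.2 i).1 * (g (E.2 i).1 - g (E.2 i).2) + (f (E.2 i).1 - f (E.2 i).2) * g (E.2 i).2 := by
    noncomm_ring
  rw [dist_eq_norm, e, dist_eq_norm, dist_eq_norm]
  refine (norm_add_le _ _).trans (add_le_add ((norm_mul_le _ _).trans ?_)
    ((norm_mul_le _ _).trans ?_))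
  · gcongr; exact hC _ h1
  · rw [mul_comm]; gcongr; exact hD _ h2

/-- `f` is absolutely continuous on the interval between `a` and `b`, with derivative `f'` almost
everywhere. -/
structure HasACDeriv [NormedSpace ℝ E] (f f' : ℝ → E) (a b : ℝ) : Prop where
  ac : AbsolutelyContinuousOnInterval f a b
  ae : ∀ᵐ x : ℝ, x ∈ uIcc a b → HasDerivAt f (f' x) x

namespace HasACDeriv

variable [NormedSpace ℝ E] [NormedSpace ℝ F] {f f' g g' : ℝ → E} {a b : ℝ}

theorem const (c : E) : HasACDeriv (fun _ ↦ c) (fun _ ↦ 0) a b :=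
  ⟨.const c a b, ae_of_all _ fun x _ ↦ hasDerivAt_const x c⟩

theorem add (hf : HasACDeriv f f' a b) (hg : HasACDeriv g g' a b) :
    HasACDeriv (fun x ↦ f x + g x) (fun x ↦ f' x + g' x) a b := by
  refine ⟨hf.ac.add hg.ac, ?_⟩
  filter_upwards [hf.ae, hg.ae] with x h1 h2 hx using (h1 hx).add (h2 hx)

theorem sub (hf : HasACDeriv f f' a b) (hg : HasACDeriv g g' a b) :
    HasACDeriv (fun x ↦ f x - g x) (fun x ↦ f' x - g' x) a b := by
  refine ⟨hf.ac.sub hg.ac, ?_⟩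
  filter_upwards [hf.ae, hg.ae] with x h1 h2 hx using (h1 hx).sub (h2 hx)

theorem sum {κ : Type*} (s : Finset κ) {f f' : κ → ℝ → E}
    (h : ∀ i ∈ s, HasACDeriv (f i) (f' i) a b) :
    HasACDeriv (fun x ↦ ∑ i ∈ s, f i x) (fun x ↦ ∑ i ∈ s, f' i x) a b := by
  classical
  induction s using Finset.induction_on with
  | empty => simpa using const (0 : E)
  | insert i s hi ih =>
    simp only [Finset.sum_insert hi]
    exact (h i (by simp)).add (ih fun j hj ↦ h j (by simp [hj]))

theorem clm (L : E →L[ℝ] F) (hf : HasACDeriv f f' a b) :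
    HasACDeriv (fun x ↦ L (f x)) (fun x ↦ L (f' x)) a b := by
  refine ⟨hf.ac.of_dist_le (K := ‖L‖) fun x _ y _ ↦ L.dist_le_opNorm _ _, ?_⟩
  filter_upwards [hf.ae] with x h1 hx using L.hasFDerivAt.comp_hasDerivAt x (h1 hx)

theorem mul {A : Type*} [NormedRing A] [NormedAlgebra ℝ A] {f f' g g' : ℝ → A}
    (hf : HasACDeriv f f' a b) (hg : HasACDeriv g g' a b) :
    HasACDeriv (fun x ↦ f x * g x) (fun x ↦ f' x * g x + f x * g' x) a b := by
  refine ⟨hf.ac.normedRing_mul hg.ac, ?_⟩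
  filter_upwards [hf.ae, hg.ae] with x h1 h2 hx using (h1 hx).mul (h2 hx)

theorem congr {g' : ℝ → E} (hf : HasACDeriv f f' a b)
    (h : ∀ᵐ x : ℝ, x ∈ uIcc a b → f' x = g' x) : HasACDeriv f g' a b := by
  refine ⟨hf.ac, ?_⟩
  filter_upwards [hf.ae, h] with x h1 h2 hx using h2 hx ▸ h1 hx

theorem mono {c d : ℝ} (hf : HasACDeriv f f' a b) (h : uIcc c d ⊆ uIcc a b) :
    HasACDeriv f f' c d := by
  refine ⟨hf.ac.mono h, ?_⟩
  filter_upwards [hf.ae] with x h1 hx using h1 (h hx)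

/-- Composition with a continuously differentiable function. -/
theorem comp_contDiff [ProperSpace E] {φ : E → F} (hφ : ContDiff ℝ 1 φ)
    (hf : HasACDeriv f f' a b) :
    HasACDeriv (fun x ↦ φ (f x)) (fun x ↦ fderiv ℝ φ (f x) (f' x)) a b := by
  obtain ⟨C, hC⟩ := hf.ac.exists_bound
  -- `f` is bounded and a C¹ map is Lipschitz on a compact ball, so the composition stays absolutely
  -- continuous.
  obtain ⟨K, hK⟩ := hφ.contDiffOn.exists_lipschitzOnWith (by norm_num)
    (convex_closedBall (0 : E) C) (isCompact_closedBall _ _)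
  refine ⟨hf.ac.of_dist_le (K := K) fun x hx y hy ↦
    hK.dist_le_mul _ (by simpa using hC x hx) _ (by simpa using hC y hy), ?_⟩
  filter_upwards [hf.ae] with x h1 hx
  exact ((hφ.differentiable (by norm_num)) (f x)).hasFDerivAt.comp_hasDerivAt x (h1 hx)

theorem of_integral [CompleteSpace E] (h : IntervalIntegrable f' volume a b)
    (hf : ∀ x, f x = f a + ∫ s in a..x, f' s) :
    HasACDeriv f f' a b := by
  have e : f = fun x ↦ f a + ∫ s in a..x, f' s := funext hf
  have : HasACDeriv (fun x ↦ ∫ s in a..x, f' s) f' a b := by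
    refine ⟨h.absolutelyContinuousOnInterval_integral, ?_⟩
    filter_upwards [h.ae_hasDerivAt_integral] with x h1 hx using h1 hx a left_mem_uIcc
  have h2 := (const (f a)).add this
  rw [e]
  simpa using h2

/-- The fundamental theorem of calculus. -/
theorem integral_eq [CompleteSpace E] (hf : HasACDeriv f f' a b)
    (h : IntervalIntegrable f' volume a b) : ∫ s in a..b, f' s = f b - f a := by
  have h1 : HasACDeriv (fun x ↦ ∫ s in a..x, f' s) f' a b := of_integral h (by simp)
  have h2 := hf.sub h1
  obtain ⟨C, hC⟩ := h2.ac.const_of_ae_hasDerivAt_zero (by simpa using h2.ae)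
  have ha := hC a left_mem_uIcc
  have hb := hC b right_mem_uIcc
  simp only [intervalIntegral.integral_same, sub_zero] at ha
  rw [ha, ← hb]; abel

theorem norm_sub_le [CompleteSpace E] {ρ : ℝ → ℝ} (hab : a ≤ b) (hf : HasACDeriv f f' a b)
    (h : IntervalIntegrable f' volume a b) (hρ : IntervalIntegrable ρ volume a b)
    (hle : ∀ᵐ x : ℝ, x ∈ uIcc a b → ‖f' x‖ ≤ ρ x) :
    ‖f b - f a‖ ≤ ∫ s in a..b, ρ s := by
  rw [← hf.integral_eq h]
  refine intervalIntegral.norm_integral_le_of_norm_le hab ?_ hρ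
  filter_upwards [hle] with x hx hx' using hx (by rw [uIcc_of_le hab]; exact Ioc_subset_Icc_self hx')

/-- Two functions with the same initial value and the same integrable derivative agree. -/
theorem eq_of_initial [CompleteSpace E] {t : ℝ} (hf : HasACDeriv f f' a b)
    (hg : HasACDeriv g f' a b) (h0 : f a = g a) (ht : t ∈ uIcc a b) : f t = g t := by
  have h2 := hf.sub hg
  obtain ⟨C, hC⟩ := h2.ac.const_of_ae_hasDerivAt_zero (by simpa using h2.ae)
  have ha := hC a left_mem_uIcc
  have hb := hC t ht
  rw [h0, sub_self] at ha
  rw [← ha] at hb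
  exact sub_eq_zero.1 hb

/-- An almost everywhere derivative may be taken integrable for real-valued functions. -/
theorem intervalIntegrable_real {f f' : ℝ → ℝ} (hf : HasACDeriv f f' a b) :
    IntervalIntegrable f' volume a b := by
  refine hf.ac.intervalIntegrable_deriv.congr_ae ?_
  rw [EventuallyEq, ae_restrict_iff' measurableSet_uIoc]
  filter_upwards [hf.ae] with x h1 hx using (h1 (uIoc_subset_uIcc hx)).deriv

end HasACDeriv

end AbsolutelyContinuous

/-! ### A holomorphic logarithm defined by an integral along a segment -/

section Logarithm

theorem Commute.ringInverse_right' {R : Type*} [Ring R] {a b : R} (h : Commute a b) :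
    Commute a (Ring.inverse b) := by
  by_cases hb : IsUnit b
  · obtain ⟨u, rfl⟩ := hb
    rw [Ring.inverse_unit]
    exact h.units_inv_right
  · rw [Ring.inverse_non_unit _ hb]
    exact Commute.zero_right a

theorem continuousAt_ringInverse {B : Type*} [NormedRing B] [CompleteSpace B]
    {M : B} (h : IsUnit M) : ContinuousAt Ring.inverse M := by
  obtain ⟨u, rfl⟩ := h
  exact NormedRing.inverse_continuousAt u

variable {B : Type*} [NormedRing B] [NormedAlgebra ℂ B]

/-- The logarithm of an element whose spectrum avoids the closed negative half-axis. -/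
noncomputable def segmentLog (M : B) : B :=
  ∫ u in (0 : ℝ)..1, (M - 1) * Ring.inverse (1 + u • (M - 1))

@[simp] theorem segmentLog_one : segmentLog (1 : B) = 0 := by simp [segmentLog]

variable [CompleteSpace B]

theorem Commute.intervalIntegral_right {c : B} {f : ℝ → B} (h : ∀ u, Commute c (f u))
    (a b : ℝ) : Commute c (∫ u in a..b, f u) := by
  by_cases hf : IntervalIntegrable f volume a b
  · have h1 := (ContinuousLinearMap.mul ℝ B c).intervalIntegral_comp_comm hf
    have h2 := ((ContinuousLinearMap.mul ℝ B).flip c).intervalIntegral_comp_comm hf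
    simp only [ContinuousLinearMap.mul_apply', ContinuousLinearMap.flip_apply] at h1 h2
    rw [Commute, SemiconjBy, ← h1, ← h2]
    exact intervalIntegral.integral_congr fun u _ ↦ (h u).eq
  · rw [intervalIntegral.integral_undef hf]
    exact Commute.zero_right c

/-- Writing `exp (l y) = exp (l x) * exp (l y - l x)` reduces the claim to the derivative of `exp`
at 0. -/
theorem HasDerivAt.exp_of_commute {l : ℝ → B} {l' : B} {x : ℝ} (hl : HasDerivAt l l' x)
    (hc : ∀ y, Commute (l x) (l y)) :
    HasDerivAt (fun y ↦ NormedSpace.exp (l y)) (NormedSpace.exp (l x) * l') x := by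
  let _ : NormedAlgebra ℚ B := NormedAlgebra.restrictScalars ℚ ℂ B
  have e : (fun y ↦ NormedSpace.exp (l y)) =
      fun y ↦ NormedSpace.exp (l x) * NormedSpace.exp (l y - l x) := by
    funext y
    rw [← NormedSpace.exp_add_of_commute ((hc y).sub_right (Commute.refl _)), add_sub_cancel]
  rw [e]
  have h0 : HasFDerivAt NormedSpace.exp (1 : B →L[ℝ] B) (l x - l x) := by
    rw [sub_self]; exact hasFDerivAt_exp_zero
  exact (h0.comp_hasDerivAt x (hl.sub_const (l x))).const_mul _

/-- With `N = M - 1` and `l x = ∫₀ˣ N (1 + u N)⁻¹ du`, all values of `l` commute and `exp (-l x) (1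
+ x N)` has derivative zero. It is 1 at `x = 0` and `exp (-l 1) M` at `x = 1`. -/
theorem exp_segmentLog {M : B} (h : ∀ u ∈ Icc (0 : ℝ) 1, IsUnit (1 + u • (M - 1))) :
    NormedSpace.exp (segmentLog M) = M := by
  let _ : NormedAlgebra ℚ B := NormedAlgebra.restrictScalars ℚ ℂ B
  set N := M - 1 with hN
  set f : ℝ → B := fun u ↦ N * Ring.inverse (1 + u • N) with hf
  set U : Set ℝ := {u | IsUnit (1 + u • N)} with hU
  have hUo : IsOpen U := Units.isOpen.preimage (f := fun u : ℝ ↦ 1 + u • N) (by fun_prop)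
  have hfc : ContinuousOn f U := fun u hu ↦ by
    refine ContinuousAt.continuousWithinAt (continuousAt_const.mul ?_)
    exact ContinuousAt.comp (f := fun u : ℝ ↦ 1 + u • N) (continuousAt_ringInverse hu)
      (by fun_prop)
  have hcomm (u v : ℝ) : Commute (f u) (f v) := by
    have h1 (u v : ℝ) : Commute (1 + u • N) (1 + v • N) := by
      refine (Commute.one_left _).add_left ?_
      refine (Commute.one_right _).add_right ?_
      exact ((Commute.refl N).smul_left u).smul_right v
    have h2 (v : ℝ) : Commute N (1 + v • N) :=
      (Commute.one_right _).add_right ((Commute.refl N).smul_right v)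
    have h3 (v : ℝ) : Commute N (Ring.inverse (1 + v • N)) := Commute.ringInverse_right' (h2 v)
    have h4 : Commute (Ring.inverse (1 + u • N)) (Ring.inverse (1 + v • N)) :=
      (h1 u v).ringInverse_ringInverse
    exact ((Commute.refl N).mul_right (h3 v)).mul_left ((h3 u).symm.mul_right h4)
  set l : ℝ → B := fun x ↦ ∫ u in (0 : ℝ)..x, f u with hl
  have hlc (x y : ℝ) : Commute (l x) (l y) :=
    Commute.intervalIntegral_right
      (fun u ↦ (Commute.intervalIntegral_right (fun v ↦ hcomm u v) 0 x).symm) 0 y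
  have hld (x : ℝ) (hx : x ∈ Icc (0 : ℝ) 1) : HasDerivAt l (f x) x := by
    refine intervalIntegral.integral_hasDerivAt_right
      (ContinuousOn.intervalIntegrable (hfc.mono ?_))
      (hfc.stronglyMeasurableAtFilter hUo x (h x hx))
      (hfc.continuousAt (hUo.mem_nhds (h x hx)))
    rw [uIcc_of_le hx.1]
    exact fun u hu ↦ h u ⟨hu.1, hu.2.trans hx.2⟩
  set G : ℝ → B := fun x ↦ NormedSpace.exp (-l x) * (1 + x • N) with hG
  have hGd (x : ℝ) (hx : x ∈ Icc (0 : ℝ) 1) : HasDerivAt G 0 x := by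
    have h1 := ((hld x hx).neg.exp_of_commute
      (fun y ↦ ((hlc x y).neg_left).neg_right)).mul
      ((((hasDerivAt_id x).smul_const N)).const_add 1)
    refine h1.congr_deriv ?_
    have h2 : f x * (1 + x • N) = N := by
      rw [hf, mul_assoc, Ring.inverse_mul_cancel _ (h x hx), mul_one]
    simp only [id, one_smul, mul_assoc, neg_mul, Pi.neg_apply]
    rw [h2]
    simp
  have hconst : G 1 = G 0 :=
    constant_of_has_deriv_right_zero (a := (0 : ℝ)) (b := 1)
      (fun x hx ↦ (hGd x hx).continuousAt.continuousWithinAt)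
      (fun x hx ↦ (hGd x (Ico_subset_Icc_self hx)).hasDerivWithinAt) 1 (by simp)
  have h0 : l 0 = 0 := intervalIntegral.integral_same
  have h1 : NormedSpace.exp (-l 1) * M = 1 := by
    have : G 1 = NormedSpace.exp (-l 1) * M := by simp [hG, hN]
    rw [← this, hconst]
    simp [hG, h0]
  have h2 : NormedSpace.exp (l 1) * NormedSpace.exp (-l 1) = 1 := by
    rw [← NormedSpace.exp_add_of_commute (Commute.refl (l 1)).neg_right, add_neg_cancel,
      NormedSpace.exp_zero]
  change NormedSpace.exp (l 1) = M
  rw [← mul_one (NormedSpace.exp (l 1)), ← h1, ← mul_assoc, h2, one_mul]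

/-- Differentiation under the integral sign; the derivative of the integrand in `z` is jointly
continuous, hence bounded on the compact product of a closed disc and `[0, 1]`. -/
theorem differentiableOn_segmentLog {M : ℂ → B} {U : Set ℂ} (hU : IsOpen U)
    (hM : DifferentiableOn ℂ M U)
    (h : ∀ z ∈ U, ∀ u ∈ Icc (0 : ℝ) 1, IsUnit (1 + u • (M z - 1))) :
    DifferentiableOn ℂ (fun z ↦ segmentLog (M z)) U := by
  intro z₀ hz₀
  obtain ⟨r, hr, hrU⟩ := Metric.nhds_basis_closedBall.mem_iff.1 (hU.mem_nhds hz₀)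
  set K := Metric.closedBall z₀ r with hK
  set inv : ℂ → ℝ → B := fun z u ↦ Ring.inverse (1 + u • (M z - 1)) with hinv
  set F : ℂ → ℝ → B := fun z u ↦ (M z - 1) * inv z u with hF
  set F' : ℂ → ℝ → B := fun z u ↦ deriv M z * inv z u +
    (M z - 1) * (-(inv z u * (u • deriv M z) * inv z u)) with hF'
  have hMc : ContinuousOn (fun p : ℂ × ℝ ↦ M p.1) (K ×ˢ Icc (0 : ℝ) 1) :=
    (hM.continuousOn.mono hrU).comp continuousOn_fst fun p hp ↦ hp.1
  have hM'c : ContinuousOn (fun p : ℂ × ℝ ↦ deriv M p.1) (K ×ˢ Icc (0 : ℝ) 1) :=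
    ((hM.deriv hU).continuousOn.mono hrU).comp continuousOn_fst fun p hp ↦ hp.1
  have hic : ContinuousOn (fun p : ℂ × ℝ ↦ inv p.1 p.2) (K ×ˢ Icc (0 : ℝ) 1) := by
    intro p hp
    exact ContinuousAt.comp_continuousWithinAt (f := fun p : ℂ × ℝ ↦ 1 + p.2 • (M p.1 - 1))
      (continuousAt_ringInverse (h p.1 (hrU hp.1) p.2 hp.2))
      ((continuousOn_const.add (continuousOn_snd.smul (hMc.sub continuousOn_const))) p hp)
  have hFc : ContinuousOn (fun p : ℂ × ℝ ↦ F p.1 p.2) (K ×ˢ Icc (0 : ℝ) 1) :=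
    (hMc.sub continuousOn_const).mul hic
  have hF'c : ContinuousOn (fun p : ℂ × ℝ ↦ F' p.1 p.2) (K ×ˢ Icc (0 : ℝ) 1) :=
    (hM'c.mul hic).add ((hMc.sub continuousOn_const).mul
      ((hic.mul (continuousOn_snd.smul hM'c)).mul hic).neg)
  obtain ⟨C, hC⟩ := ((isCompact_closedBall z₀ r).prod
    (isCompact_Icc (a := (0 : ℝ)) (b := 1))).exists_bound_of_continuousOn hF'c
  have slice {f : ℂ → ℝ → B}
      (hf : ContinuousOn (fun p : ℂ × ℝ ↦ f p.1 p.2) (K ×ˢ Icc (0 : ℝ) 1)) {z : ℂ}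
      (hz : z ∈ K) : ContinuousOn (f z) (uIcc 0 1) := by
    rw [uIcc_of_le zero_le_one]
    exact hf.comp (f := fun u : ℝ ↦ (z, u)) (by fun_prop) fun u hu ↦ ⟨hz, hu⟩
  have hz₀K : z₀ ∈ K := Metric.mem_closedBall_self hr.le
  have meas {f : ℝ → B} (hf : ContinuousOn f (uIcc 0 1)) :
      AEStronglyMeasurable f (volume.restrict (uIoc (0 : ℝ) 1)) :=
    (hf.mono uIoc_subset_uIcc).aestronglyMeasurable measurableSet_uIoc
  have key := intervalIntegral.hasDerivAt_integral_of_dominated_loc_of_deriv_le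
    (μ := volume) (a := 0) (b := 1) (F := F) (F' := F') (x₀ := z₀) (bound := fun _ ↦ C)
    (Metric.ball_mem_nhds z₀ hr)
    (by filter_upwards [Metric.ball_mem_nhds z₀ hr] with z hz
        exact meas (slice hFc (Metric.ball_subset_closedBall hz)))
    (slice hFc hz₀K).intervalIntegrable (meas (slice hF'c hz₀K))
    (ae_of_all _ fun u hu z hz ↦ hC (z, u) ⟨Metric.ball_subset_closedBall hz, by
      have := uIoc_subset_uIcc hu; rwa [uIcc_of_le zero_le_one] at this⟩)
    intervalIntegrable_const
    (ae_of_all _ fun u hu z hz ↦ by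
      have hzU := hrU (Metric.ball_subset_closedBall hz)
      have hu' : u ∈ Icc (0 : ℝ) 1 := by
        have := uIoc_subset_uIcc hu; rwa [uIcc_of_le zero_le_one] at this
      have hMz : HasDerivAt M (deriv M z) z := (hM.differentiableAt (hU.mem_nhds hzU)).hasDerivAt
      obtain ⟨v, hv⟩ := h z hzU u hu'
      have h1 : HasDerivAt (fun z ↦ 1 + u • (M z - 1)) (u • deriv M z) z :=
        ((hMz.sub_const 1).const_smul u).const_add 1
      have h2 : HasDerivAt (fun z ↦ inv z u) (-(inv z u * (u • deriv M z) * inv z u)) z := by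
        have h3 := (hv ▸ hasFDerivAt_ringInverse (𝕜 := ℂ) v :
          HasFDerivAt Ring.inverse _ (1 + u • (M z - 1))).comp_hasDerivAt z h1
        refine h3.congr_deriv ?_
        simp [hinv, ← hv]
      exact (hMz.sub_const 1).mul h2)
  exact key.2.differentiableAt.differentiableWithinAt

end Logarithm

/-! ### Growth and rotation of solutions of linear equations -/

section Angle

variable {E : Type*} [NormedAddCommGroup E] [InnerProductSpace ℝ E]

open scoped RealInnerProductSpace

theorem hasFDerivAt_normSq_add (v : E) (δ : ℝ) :
    HasFDerivAt (fun v : E ↦ ‖v‖ ^ 2 + δ) (2 • innerSL ℝ v) v :=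
  (hasStrictFDerivAt_norm_sq v).hasFDerivAt.add_const δ

theorem contDiff_log_normSq_add {δ : ℝ} (hδ : 0 < δ) :
    ContDiff ℝ 1 fun v : E ↦ Real.log (‖v‖ ^ 2 + δ) :=
  ((contDiff_norm_sq ℝ).add contDiff_const).log fun v ↦ by positivity

/-- The shift by `δ` makes the logarithm smooth at `v = 0`, and the bound does not depend on `δ`, so
that `δ → 0` is possible later. -/
theorem abs_fderiv_log_normSq_add_le {δ : ℝ} (hδ : 0 < δ) (v w : E) {r : ℝ} (hr : 0 ≤ r)
    (h : ‖w‖ ≤ r * ‖v‖) :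
    |fderiv ℝ (fun v : E ↦ Real.log (‖v‖ ^ 2 + δ)) v w| ≤ 2 * r := by
  have hq : 0 < ‖v‖ ^ 2 + δ := by positivity
  rw [((hasFDerivAt_normSq_add v δ).log hq.ne').fderiv]
  simp only [smul_apply, innerSL_apply_apply, smul_eq_mul, nsmul_eq_mul]
  rw [abs_mul, abs_inv, abs_of_pos hq, inv_mul_le_iff₀ hq, abs_mul]
  have h1 := abs_real_inner_le_norm v w
  have h2 : ‖v‖ * ‖w‖ ≤ ‖v‖ * (r * ‖v‖) := by gcongr
  rw [Nat.cast_ofNat, abs_two]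
  nlinarith [mul_nonneg hr hδ.le]

theorem hasFDerivAt_cosine {δ : ℝ} (hδ : 0 < δ) (m v : E) :
    HasFDerivAt (fun v : E ↦ ⟪m, v⟫ / √(‖v‖ ^ 2 + δ))
      ((√(‖v‖ ^ 2 + δ))⁻¹ • innerSL ℝ (m - (⟪m, v⟫ / (‖v‖ ^ 2 + δ)) • v)) v := by
  have hq : 0 < ‖v‖ ^ 2 + δ := by positivity
  have h1 : HasFDerivAt (fun v : E ↦ ⟪m, v⟫) (innerSL ℝ m) v := (innerSL ℝ m).hasFDerivAt
  have h2 := (hasFDerivAt_normSq_add v δ).sqrt hq.ne'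
  have hs : √(‖v‖ ^ 2 + δ) ≠ 0 := (Real.sqrt_pos.2 hq).ne'
  have h3 := h1.mul ((hasDerivAt_inv hs).comp_hasFDerivAt v h2)
  simp only [div_eq_mul_inv]
  refine h3.congr_fderiv ?_
  ext w
  have hsq : √(‖v‖ ^ 2 + δ) ^ 2 = ‖v‖ ^ 2 + δ := Real.sq_sqrt hq.le
  simp only [add_apply, smul_apply, innerSL_apply_apply,
    smul_eq_mul, nsmul_eq_mul, Function.comp, inner_sub_left, inner_smul_left, Nat.cast_ofNat,
    RCLike.conj_to_real]
  clear h1 h2 h3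
  generalize √(‖v‖ ^ 2 + δ) = S at *
  rw [← hsq]
  field_simp
  ring

theorem cosine_sq_lt_one {δ : ℝ} (hδ : 0 < δ) {m : E} (hm : ‖m‖ = 1) (v : E) :
    (⟪m, v⟫ / √(‖v‖ ^ 2 + δ)) ^ 2 < 1 := by
  have hq : 0 < ‖v‖ ^ 2 + δ := by positivity
  rw [div_pow, Real.sq_sqrt hq.le, div_lt_one hq]
  have h1 := abs_real_inner_le_norm m v
  rw [hm, one_mul] at h1
  have := sq_le_sq' (by linarith [neg_abs_le ⟪m, v⟫, h1]) ((le_abs_self _).trans h1)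
  linarith

theorem contDiff_arcsin_cosine {δ : ℝ} (hδ : 0 < δ) {m : E} (hm : ‖m‖ = 1) :
    ContDiff ℝ 1 fun v : E ↦ Real.arcsin (⟪m, v⟫ / √(‖v‖ ^ 2 + δ)) := by
  rw [contDiff_iff_contDiffAt]
  intro v
  have hq : 0 < ‖v‖ ^ 2 + δ := by positivity
  have h1 := cosine_sq_lt_one hδ hm v
  have hs : √(‖v‖ ^ 2 + δ) ≠ 0 := (Real.sqrt_pos.2 hq).ne'
  refine (Real.contDiffAt_arcsin ?_ ?_).comp v ?_
  · intro h; rw [h] at h1; norm_num at h1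
  · intro h; rw [h] at h1; norm_num at h1
  · exact (contDiff_const.inner ℝ contDiff_id).contDiffAt.div
      ((((contDiff_norm_sq ℝ).add contDiff_const).contDiffAt).sqrt hq.ne') hs

/-- The speed of rotation. For `δ = 0` the vector `u` below is the part of `m` orthogonal to `v`, of
norm `√(1 - c ^ 2)`, which cancels the derivative of `arcsin` at the cosine `c`. For `δ > 0` the
norm of `u` is still at most this, and `c` stays away from `±1`, where `arcsin` is not smooth. -/
theorem abs_fderiv_arcsin_cosine_le {δ : ℝ} (hδ : 0 < δ) {m : E} (hm : ‖m‖ = 1) (v w : E)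
    {r : ℝ} (hr : 0 ≤ r) (h : ‖w‖ ≤ r * ‖v‖) :
    |fderiv ℝ (fun v : E ↦ Real.arcsin (⟪m, v⟫ / √(‖v‖ ^ 2 + δ))) v w| ≤ r := by
  have hq : 0 < ‖v‖ ^ 2 + δ := by positivity
  have h1 := cosine_sq_lt_one hδ hm v
  set q := ‖v‖ ^ 2 + δ with hqd
  have hs : 0 < √q := Real.sqrt_pos.2 hq
  set c := ⟪m, v⟫ / √q with hc
  have hd := (Real.hasDerivAt_arcsin (x := c) (by rintro h; rw [h] at h1; norm_num at h1)
    (by rintro h; rw [h] at h1; norm_num at h1)).comp_hasFDerivAt v (hasFDerivAt_cosine hδ m v)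
  have hd' : HasFDerivAt (fun v : E ↦ Real.arcsin (⟪m, v⟫ / √(‖v‖ ^ 2 + δ))) _ v := hd
  rw [hd'.fderiv]
  simp only [smul_apply, innerSL_apply_apply, smul_eq_mul]
  rw [← hqd]
  set u := m - (⟪m, v⟫ / q) • v with hu
  have hc1 : 0 < 1 - c ^ 2 := by linarith
  have hsc : 0 < √(1 - c ^ 2) := Real.sqrt_pos.2 hc1
  have hu2 : ‖u‖ ^ 2 ≤ 1 - c ^ 2 := by
    have e : ‖u‖ ^ 2 = 1 - 2 * (⟪m, v⟫ ^ 2 / q) + (⟪m, v⟫ / q) ^ 2 * ‖v‖ ^ 2 := by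
      rw [hu, norm_sub_sq_real, hm, norm_smul, inner_smul_right, mul_pow, Real.norm_eq_abs, sq_abs]
      ring
    have e2 : c ^ 2 = ⟪m, v⟫ ^ 2 / q := by rw [hc, div_pow, Real.sq_sqrt hq.le]
    have e3 : (⟪m, v⟫ / q) ^ 2 * ‖v‖ ^ 2 ≤ ⟪m, v⟫ ^ 2 / q := by
      rw [div_pow, div_mul_eq_mul_div, div_le_div_iff₀ (by positivity) hq, sq q, mul_assoc]
      have : ‖v‖ ^ 2 ≤ q := by rw [hqd]; linarith
      have h5 : ‖v‖ ^ 2 * q ≤ q * q := by gcongr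
      exact mul_le_mul_of_nonneg_left h5 (sq_nonneg _)
    rw [e, e2]; linarith
  have hu1 : ‖u‖ ≤ √(1 - c ^ 2) := Real.le_sqrt_of_sq_le hu2
  have hv : ‖v‖ ≤ √q := Real.le_sqrt_of_sq_le (by rw [hqd]; linarith)
  rw [abs_mul, abs_mul, abs_of_pos (by positivity : 0 < 1 / √(1 - c ^ 2)),
    abs_of_pos (by positivity : 0 < (√q)⁻¹), one_div, inv_mul_le_iff₀ hsc, inv_mul_le_iff₀ hs]
  calc |⟪u, w⟫| ≤ ‖u‖ * ‖w‖ := abs_real_inner_le_norm _ _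
    _ ≤ √(1 - c ^ 2) * (r * √q) := by gcongr; exact h.trans (by gcongr)
    _ = √q * (√(1 - c ^ 2) * r) := by ring

variable [FiniteDimensional ℝ E] {y y' : ℝ → E} {ρ : ℝ → ℝ} {t : ℝ}

/-- Chain rule and integration. It is applied to the regularised logarithm of the norm, with `K =
2`, and to the regularised angle, with `K = 1`. -/
theorem HasACDeriv.abs_comp_sub_le (ht : 0 ≤ t) (hy : HasACDeriv y y' 0 t)
    (hρ : IntervalIntegrable ρ volume 0 t) (hρ0 : ∀ s, 0 ≤ ρ s)
    (hle : ∀ᵐ s : ℝ, s ∈ uIcc 0 t → ‖y' s‖ ≤ ρ s * ‖y s‖)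
    {g : E → ℝ} (hg : ContDiff ℝ 1 g) {K : ℝ}
    (hK : ∀ v w : E, ∀ r : ℝ, 0 ≤ r → ‖w‖ ≤ r * ‖v‖ → |fderiv ℝ g v w| ≤ K * r) :
    |g (y t) - g (y 0)| ≤ K * ∫ s in (0 : ℝ)..t, ρ s := by
  have := FiniteDimensional.proper_real E
  have h := hy.comp_contDiff hg
  rw [← intervalIntegral.integral_const_mul]
  refine h.norm_sub_le ht h.intervalIntegrable_real (hρ.const_mul K) ?_
  filter_upwards [hle] with s hs hs' using hK _ _ _ (hρ0 s) (hs hs')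

/-- For `b = 0` the hypothesis gives `a ^ 2 ≤ δ * exp I`; let `δ → 0`. -/
theorem eq_zero_of_abs_log_sub_log_le {a b I : ℝ} (ha : 0 ≤ a)
    (h : ∀ δ > 0, |Real.log (b ^ 2 + δ) - Real.log (a ^ 2 + δ)| ≤ I) (hb : b = 0) : a = 0 := by
  subst hb
  by_contra ha0
  have hlim : Tendsto (fun δ : ℝ ↦ δ * Real.exp I) (𝓝[>] 0) (𝓝 (0 * Real.exp I)) :=
    (tendsto_id.mul_const _).mono_left nhdsWithin_le_nhds
  have : a ^ 2 ≤ 0 * Real.exp I := by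
    refine ge_of_tendsto hlim ?_
    filter_upwards [self_mem_nhdsWithin] with δ hδ
    have hδ : 0 < δ := hδ
    have h1 := neg_le_of_abs_le (h δ hδ)
    have h2 : Real.log (a ^ 2 + δ) ≤ Real.log (δ * Real.exp I) := by
      rw [Real.log_mul hδ.ne' (Real.exp_pos _).ne', Real.log_exp]
      simp only [ne_eq, OfNat.ofNat_ne_zero, not_false_eq_true, zero_pow, zero_add] at h1
      linarith
    have := (Real.log_le_log_iff (by positivity) (by positivity)).1 h2
    linarith
  have : 0 < a ^ 2 := by positivity
  linarith

/-- A solution of a linear equation vanishes at the end if and only if it does at the start. -/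
theorem HasACDeriv.eq_zero_iff (ht : 0 ≤ t) (hy : HasACDeriv y y' 0 t)
    (hρ : IntervalIntegrable ρ volume 0 t) (hρ0 : ∀ s, 0 ≤ ρ s)
    (hle : ∀ᵐ s : ℝ, s ∈ uIcc 0 t → ‖y' s‖ ≤ ρ s * ‖y s‖) : y t = 0 ↔ y 0 = 0 := by
  have h (δ : ℝ) (hδ : 0 < δ) := hy.abs_comp_sub_le ht hρ hρ0 hle (contDiff_log_normSq_add hδ)
    fun v w r hr hw ↦ abs_fderiv_log_normSq_add_le hδ v w hr hw
  constructor
  · intro h0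
    exact norm_eq_zero.1 (eq_zero_of_abs_log_sub_log_le (norm_nonneg (y 0)) h (by simp [h0]))
  · intro h0
    exact norm_eq_zero.1 (eq_zero_of_abs_log_sub_log_le (norm_nonneg (y t))
      (fun δ hδ ↦ by rw [abs_sub_comm]; exact h δ hδ) (by simp [h0]))

/-- A solution of a linear equation turns by an angle of at most the integral of the norm of the
coefficient, so that it cannot reach the opposite direction before this integral is `π`. -/
theorem HasACDeriv.ne_neg_smul (ht : 0 ≤ t) (hy : HasACDeriv y y' 0 t)
    (hρ : IntervalIntegrable ρ volume 0 t) (hρ0 : ∀ s, 0 ≤ ρ s)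
    (hle : ∀ᵐ s : ℝ, s ∈ uIcc 0 t → ‖y' s‖ ≤ ρ s * ‖y s‖)
    (hI : ∫ s in (0 : ℝ)..t, ρ s < Real.pi) (h0 : y 0 ≠ 0) {c : ℝ} (hc : 0 < c) :
    y t ≠ -(c • y 0) := by
  intro hyt
  have hn : 0 < ‖y 0‖ := norm_pos_iff.2 h0
  set m : E := ‖y 0‖⁻¹ • y 0 with hm
  have hm1 : ‖m‖ = 1 := by rw [hm, norm_smul, norm_inv, norm_norm, inv_mul_cancel₀ hn.ne']
  have hlim (a : ℝ) (ha : 0 < a) :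
      Tendsto (fun δ : ℝ ↦ Real.arcsin (a / √(a ^ 2 + δ))) (𝓝[>] 0) (𝓝 (Real.pi / 2)) := by
    have h1 : Tendsto (fun δ : ℝ ↦ Real.arcsin (a / √(a ^ 2 + δ))) (𝓝 0)
        (𝓝 (Real.arcsin (a / √(a ^ 2 + 0)))) := by
      refine (Real.continuous_arcsin.tendsto _).comp ?_
      refine tendsto_const_nhds.div ?_ (by rw [add_zero, Real.sqrt_sq ha.le]; exact ha.ne')
      exact (Real.continuous_sqrt.tendsto _).comp (tendsto_const_nhds.add tendsto_id)
    rw [add_zero, Real.sqrt_sq ha.le, div_self ha.ne', Real.arcsin_one] at h1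
    exact h1.mono_left nhdsWithin_le_nhds
  -- As `δ → 0` the regularised angle tends to `π / 2` at time 0 and would tend to `-π / 2` at time
  -- `t`; a total change of `π` exceeds the integral of `ρ`.
  have hsum := (hlim ‖y 0‖ hn).add (hlim (c * ‖y 0‖) (by positivity))
  rw [add_halves] at hsum
  refine absurd (le_of_tendsto hsum ?_) (not_le.2 hI)
  filter_upwards [self_mem_nhdsWithin] with δ hδ
  have h := hy.abs_comp_sub_le ht hρ hρ0 hle (contDiff_arcsin_cosine hδ hm1) (K := 1)
    fun v w r hr hw ↦ by rw [one_mul]; exact abs_fderiv_arcsin_cosine_le hδ hm1 v w hr hw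
  have e1 : ⟪m, y 0⟫ = ‖y 0‖ := by
    rw [hm, inner_smul_left, real_inner_self_eq_norm_sq]
    simp only [conj_trivial]
    field_simp
  rw [hyt, inner_neg_right, inner_smul_right, e1, norm_neg, norm_smul, Real.norm_of_nonneg hc.le,
    neg_div, Real.arcsin_neg, one_mul] at h
  have := neg_le_of_abs_le h
  linarith

end Angle

/-! ### Derivative of the exponential of a noncommutative formal power series -/

section Formal

open PowerSeries

variable {R : Type*} [Ring R]

theorem PowerSeries.X_pow_dvd_mul {p q : R⟦X⟧} {i j : ℕ} (hp : X ^ i ∣ p) (hq : X ^ j ∣ q) :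
    X ^ (i + j) ∣ p * q := by
  obtain ⟨p', rfl⟩ := hp
  obtain ⟨q', rfl⟩ := hq
  refine ⟨p' * q', ?_⟩
  have h : X ^ j * p' = p' * X ^ j := (commute_X_pow p' j).symm.eq
  rw [pow_add, mul_assoc, mul_assoc, ← mul_assoc p', ← h, mul_assoc]

theorem PowerSeries.X_pow_dvd_pow {p : R⟦X⟧} (hp : X ∣ p) (k : ℕ) : X ^ k ∣ p ^ k := by
  induction k with
  | zero => simp
  | succ k ih => rw [pow_succ p]; exact X_pow_dvd_mul ih (by simpa using hp)

variable [Algebra ℚ R]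

theorem PowerSeries.X_pow_dvd_smul {p : R⟦X⟧} {j : ℕ} (c : ℚ) (hp : X ^ j ∣ p) :
    X ^ j ∣ c • p := by
  obtain ⟨q, rfl⟩ := hp
  exact ⟨c • q, (mul_smul_comm _ _ _).symm⟩

/-- The operator `y ↦ x * y - y * x`. -/
noncomputable def commutatorEnd (x : R⟦X⟧) : Module.End ℚ R⟦X⟧ :=
  LinearMap.mulLeft ℚ x - LinearMap.mulRight ℚ x

theorem commutatorEnd_apply (x y : R⟦X⟧) : commutatorEnd x y = x * y - y * x := rfl

theorem mul_eq_commutatorEnd_add (x y : R⟦X⟧) : x * y = commutatorEnd x y + y * x := by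
  rw [commutatorEnd_apply, sub_add_cancel]

theorem commutatorEnd_pow_succ_apply (x y : R⟦X⟧) (k : ℕ) :
    (commutatorEnd x ^ (k + 1)) y = commutatorEnd x ((commutatorEnd x ^ k) y) := by
  rw [pow_succ', Module.End.mul_apply]

theorem X_pow_dvd_commutatorEnd_pow {x y : R⟦X⟧} (hx : X ∣ x) {j : ℕ} (hy : X ^ j ∣ y) (k : ℕ) :
    X ^ (k + j) ∣ (commutatorEnd x ^ k) y := by
  induction k with
  | zero => simpa using hy
  | succ k ih =>
    rw [commutatorEnd_pow_succ_apply, commutatorEnd_apply]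
    have hx' : X ^ 1 ∣ x := by simpa using hx
    refine dvd_sub ?_ ?_
    · rw [show k + 1 + j = 1 + (k + j) by ring]; exact X_pow_dvd_mul hx' ih
    · rw [show k + 1 + j = (k + j) + 1 by ring]; exact X_pow_dvd_mul ih hx'

/-- The derivative of `x ^ k` in the direction `d`. -/
noncomputable def powDeriv (x d : R⟦X⟧) : ℕ → R⟦X⟧
  | 0 => 0
  | k + 1 => d * x ^ k + x * powDeriv x d k

/-- Each factor `x` on the left of `d` is moved to the right by `x y = ad_x y + y x`; Pascal's rule
collects the terms. -/
theorem powDeriv_eq_sum (x d : R⟦X⟧) (k : ℕ) :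
    powDeriv x d k =
      ∑ m ∈ Finset.range k, (k.choose (m + 1)) • ((commutatorEnd x ^ m) d * x ^ (k - 1 - m)) := by
  induction k with
  | zero => simp [powDeriv]
  | succ k ih =>
    have e1 : ∑ m ∈ Finset.range (k + 1),
        (k + 1).choose (m + 1) • ((commutatorEnd x ^ m) d * x ^ (k + 1 - 1 - m)) =
        ∑ m ∈ Finset.range (k + 1), k.choose m • ((commutatorEnd x ^ m) d * x ^ (k - m)) +
        ∑ m ∈ Finset.range (k + 1),
          k.choose (m + 1) • ((commutatorEnd x ^ m) d * x ^ (k - m)) := by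
      rw [← Finset.sum_add_distrib]
      refine Finset.sum_congr rfl fun m _ ↦ ?_
      rw [Nat.choose_succ_succ, add_smul, Nat.add_sub_cancel]
    rw [e1, Finset.sum_range_succ', Finset.sum_range_succ (n := k)]
    simp only [powDeriv, ih, Finset.mul_sum, Nat.choose_succ_self, zero_smul, add_zero, pow_zero,
      Nat.choose_zero_right, one_smul, Module.End.one_apply, Nat.sub_zero]
    rw [add_comm, add_right_comm, ← Finset.sum_add_distrib]
    congr 1
    refine Finset.sum_congr rfl fun m hm ↦ ?_
    have hmk := Finset.mem_range.1 hm
    rw [mul_smul_comm, ← mul_assoc, mul_eq_commutatorEnd_add x, ← commutatorEnd_pow_succ_apply,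
      add_mul, smul_add, mul_assoc, ← pow_succ', show k - 1 - m + 1 = k - m by omega,
      show k - (m + 1) = k - 1 - m by omega]

/-- The truncated exponential `∑ k ≤ N, x ^ k / k!`. -/
noncomputable def truncExp (N : ℕ) (x : R⟦X⟧) : R⟦X⟧ :=
  ∑ k ∈ Finset.range (N + 1), (k.factorial : ℚ)⁻¹ • x ^ k

/-- Division by the factorial turns the binomial coefficients into products of inverse factorials.
The double sum becomes a truncated product of `((e^ad - 1)/ad)(d)` and `e^x`. -/
theorem sum_powDeriv_eq (x d : R⟦X⟧) (N : ℕ) :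
    ∑ k ∈ Finset.range (N + 1), (k.factorial : ℚ)⁻¹ • powDeriv x d k =
      ∑ m ∈ Finset.range N, ((m + 1).factorial : ℚ)⁻¹ • (commutatorEnd x ^ m) d *
        ∑ l ∈ Finset.range (N - m), (l.factorial : ℚ)⁻¹ • x ^ l := by
  simp only [Finset.mul_sum]
  rw [← Finset.sum_range_diag_flip N fun m l ↦
    ((m + 1).factorial : ℚ)⁻¹ • (commutatorEnd x ^ m) d * (l.factorial : ℚ)⁻¹ • x ^ l,
    Finset.sum_range_succ']
  simp only [powDeriv, smul_zero, add_zero]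
  refine Finset.sum_congr rfl fun k _ ↦ ?_
  rw [← powDeriv, powDeriv_eq_sum, Finset.smul_sum]
  refine Finset.sum_congr rfl fun m hm ↦ ?_
  have hmk := Finset.mem_range.1 hm
  rw [smul_mul_smul_comm, ← Nat.cast_smul_eq_nsmul ℚ, smul_smul, Nat.succ_eq_add_one, Nat.add_sub_cancel]
  congr 1
  rw [Nat.cast_choose ℚ (show m + 1 ≤ k + 1 by omega), Nat.add_sub_add_right]
  have := Nat.factorial_ne_zero (k + 1)
  field_simp

theorem X_pow_dvd_sum_powDeriv_sub {x d : R⟦X⟧} (hx : X ∣ x) (hd : X ∣ d) (N : ℕ) :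
    X ^ (N + 1) ∣ ∑ k ∈ Finset.range (N + 1), (k.factorial : ℚ)⁻¹ • powDeriv x d k -
      (∑ m ∈ Finset.range N, ((m + 1).factorial : ℚ)⁻¹ • (commutatorEnd x ^ m) d) *
        truncExp N x := by
  rw [sum_powDeriv_eq, Finset.sum_mul, ← Finset.sum_sub_distrib]
  refine Finset.dvd_sum fun m hm ↦ ?_
  have hmN := Finset.mem_range.1 hm
  rw [← mul_sub, ← neg_sub, mul_neg, dvd_neg, truncExp,
    ← Finset.sum_Ico_eq_sub _ (show N - m ≤ N + 1 by omega),
    show N + 1 = (m + 1) + (N - m) by omega]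
  -- `ad_x ^ m d` has order at least `m + 1`, and the missing powers `x ^ l` have `l ≥ N - m`.
  refine X_pow_dvd_mul (X_pow_dvd_smul _ ?_) (Finset.dvd_sum fun l hl ↦ X_pow_dvd_smul _ ?_)
  · exact X_pow_dvd_commutatorEnd_pow hx (by simpa using hd) m
  · exact (pow_dvd_pow X (Finset.mem_Ico.1 hl).1).trans (X_pow_dvd_pow hx l)

/-- The power series `(exp T - 1) / T`. -/
noncomputable def expSubOneDivX : ℚ⟦X⟧ := PowerSeries.mk fun m ↦ ((m + 1).factorial : ℚ)⁻¹

theorem expSubOneDivX_mul_bernoulli : expSubOneDivX * bernoulliPowerSeries ℚ = 1 := by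
  have h1 : (X : ℚ⟦X⟧) * expSubOneDivX = exp ℚ - 1 := by
    ext n
    cases n with
    | zero => simp
    | succ n => simp [expSubOneDivX, coeff_succ_X_mul, coeff_exp, coeff_one]
  have h2 := bernoulliPowerSeries_mul_exp_sub_one ℚ
  rw [← h1] at h2
  refine mul_left_cancel₀ (X_ne_zero (R := ℚ)) ?_
  rw [mul_one, ← mul_assoc, mul_comm, h2]

theorem aeval_trunc_apply (u : Module.End ℚ R⟦X⟧) (f : ℚ⟦X⟧) (N : ℕ) (y : R⟦X⟧) :
    Polynomial.aeval u (trunc N f) y = ∑ k ∈ Finset.range N, coeff k f • (u ^ k) y := by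
  rw [trunc_apply, map_sum, LinearMap.sum_apply, Nat.Ico_zero_eq_range]
  refine Finset.sum_congr rfl fun k _ ↦ ?_
  rw [Polynomial.aeval_monomial, Module.End.mul_apply, Module.algebraMap_end_apply]

theorem X_pow_dvd_aeval_commutatorEnd {x y : R⟦X⟧} (hx : X ∣ x) {j : ℕ} (hy : X ^ j ∣ y)
    (p : Polynomial ℚ) : X ^ j ∣ Polynomial.aeval (commutatorEnd x) p y := by
  rw [Polynomial.aeval_eq_sum_range, LinearMap.sum_apply]
  refine Finset.dvd_sum fun k _ ↦ X_pow_dvd_smul _ ?_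
  exact (pow_dvd_pow X (Nat.le_add_left j k)).trans (X_pow_dvd_commutatorEnd_pow hx hy k)

theorem X_pow_dvd_trunc_mul_trunc_sub_one {f g : ℚ⟦X⟧} (h : f * g = 1) (N : ℕ) :
    Polynomial.X ^ N ∣ trunc N f * trunc N g - 1 := by
  rw [Polynomial.X_pow_dvd_iff]
  intro d hd
  have h1 := congrArg (coeff d) h
  rw [coeff_mul_eq_coeff_trunc_mul_trunc (n := N) f g hd] at h1
  rw [Polynomial.coeff_sub, ← Polynomial.coeff_coe, Polynomial.coe_mul, h1, coeff_one,
    Polynomial.coeff_one]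
  simp

/-- If `d = g(ad_x) b` then `f(ad_x) d = b`, up to degree `N`. The truncations of `f` and `g`
multiply to 1 modulo `T ^ N`, and `ad_x ^ N b` has order at least `N + 1` since `b` has order at
least 1. -/
theorem X_pow_dvd_inverse_series_sub {x d b : R⟦X⟧} (hx : X ∣ x) (hb : X ∣ b) {N : ℕ}
    {f g : ℚ⟦X⟧} (h : f * g = 1)
    (hd : X ^ (N + 1) ∣ d - ∑ k ∈ Finset.range N, coeff k g • (commutatorEnd x ^ k) b) :
    X ^ (N + 1) ∣ ∑ m ∈ Finset.range N, coeff m f • (commutatorEnd x ^ m) d - b := by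
  obtain ⟨q, hq⟩ := X_pow_dvd_trunc_mul_trunc_sub_one h N
  rw [← aeval_trunc_apply] at hd ⊢
  set u := commutatorEnd x
  have h1 := X_pow_dvd_aeval_commutatorEnd hx hd (trunc N f)
  rw [map_sub, ← Module.End.mul_apply, ← map_mul, sub_eq_iff_eq_add'.1 hq, map_add, map_one,
    mul_comm, map_mul, LinearMap.add_apply, Module.End.one_apply, Module.End.mul_apply, map_pow,
    Polynomial.aeval_X] at h1
  have h2 := X_pow_dvd_aeval_commutatorEnd hx
    (X_pow_dvd_commutatorEnd_pow hx (j := 1) (by simpa using hb) N) q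
  have h3 := dvd_add h1 h2
  convert h3 using 1
  abel

/-- The Magnus equation for `x` with derivative `d` yields `(e^x)' = a e^x`, because the Bernoulli
series is the inverse of `(e^T - 1)/T`. -/
theorem X_pow_dvd_sum_powDeriv_sub_mul_truncExp {x d a : R⟦X⟧} (hx : X ∣ x) (ha : X ∣ a)
    {N : ℕ} (hd : X ^ (N + 1) ∣ d - ∑ k ∈ Finset.range N,
      coeff k (bernoulliPowerSeries ℚ) • (commutatorEnd x ^ k) a) (hd1 : X ∣ d) :
    X ^ (N + 1) ∣ ∑ k ∈ Finset.range (N + 1), (k.factorial : ℚ)⁻¹ • powDeriv x d k -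
      a * truncExp N x := by
  have h1 := X_pow_dvd_sum_powDeriv_sub hx hd1 N
  have h2 := X_pow_dvd_inverse_series_sub hx ha expSubOneDivX_mul_bernoulli hd
  simp only [expSubOneDivX, coeff_mk] at h2
  have h3 := dvd_add h1 (Dvd.dvd.mul_right h2 (truncExp N x))
  rwa [sub_mul, sub_add_sub_cancel] at h3

end Formal

/-! ### The Magnus series as the formal logarithm of the Dyson series -/

section MagnusFormal

open PowerSeries

variable {ι : Type*} [Fintype ι]

theorem coeff_commutatorEnd_pow_C (x : (Matrix ι ι ℝ)⟦X⟧) [DecidableEq ι] (a : Matrix ι ι ℝ)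
    (k n : ℕ) : coeff n ((commutatorEnd x ^ k) (C a)) =
      adPowCoeff (fun m ↦ coeff m x) a k n := by
  induction k generalizing n with
  | zero => simp [adPowCoeff, coeff_C]
  | succ k ih =>
    rw [commutatorEnd_pow_succ_apply, commutatorEnd_apply, map_sub, coeff_mul, coeff_mul,
      adPowCoeff, Finset.sum_sub_distrib]
    simp only [ih]
    congr 1
    exact Finset.Nat.sum_antidiagonal_swap
      (f := fun p ↦ adPowCoeff (fun m ↦ coeff m x) a k p.2 * coeff p.1 x)

theorem adPowCoeff_congr {W W' : ℕ → Matrix ι ι ℝ} {a : Matrix ι ι ℝ} {n : ℕ}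
    (h : ∀ m ≤ n, W m = W' m) (k : ℕ) : adPowCoeff W a k n = adPowCoeff W' a k n := by
  induction k generalizing n with
  | zero => rfl
  | succ k ih =>
    refine Finset.sum_congr rfl fun p hp ↦ ?_
    have hp := Finset.HasAntidiagonal.mem_antidiagonal.1 hp
    rw [h p.1 (by omega), ih fun m hm ↦ h m (by omega)]

variable [DecidableEq ι]

/-- The integrand in the definition of the terms of the Magnus series. -/
noncomputable def magnusIntegrand (A : ℝ → Matrix ι ι ℝ) : ℕ → ℝ → Matrix ι ι ℝ
  | 0 => fun _ ↦ 0
  | n + 1 => fun s ↦ ∑ k ∈ Finset.range (n + 1),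
      ((bernoulli k : ℝ) / (k.factorial : ℝ)) •
        adPowCoeff (fun m ↦ magnusTerm A m s) (A s) k n

theorem magnusTerm_eq_integral (A : ℝ → Matrix ι ι ℝ) (n : ℕ) (t : ℝ) :
    magnusTerm A n t = ∫ s in (0 : ℝ)..t, magnusIntegrand A n s := by
  cases n with
  | zero => simp [magnusTerm, magnusIntegrand]
  | succ n =>
    rw [magnusTerm]
    refine intervalIntegral.integral_congr fun s _ ↦ ?_
    simp only [magnusIntegrand]
    refine Finset.sum_congr rfl fun k _ ↦ ?_
    rw [adPowCoeff_congr fun m hm ↦ ?_]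
    simp [hm]

theorem intervalIntegrable_adPowCoeff {W : ℕ → ℝ → Matrix ι ι ℝ} {A : ℝ → Matrix ι ι ℝ}
    {a b : ℝ} (hA : IntervalIntegrable A volume a b) {n : ℕ}
    (hW : ∀ m ≤ n, ContinuousOn (W m) (uIcc a b)) (k : ℕ) :
    IntervalIntegrable (fun s ↦ adPowCoeff (fun m ↦ W m s) (A s) k n) volume a b := by
  induction k generalizing n with
  | zero =>
    simp only [adPowCoeff]
    split_ifs
    · exact hA
    · exact intervalIntegrable_const
  | succ k ih =>
    simp only [adPowCoeff]
    have := IntervalIntegrable.sum (μ := volume) (a := a) (b := b)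
      (Finset.HasAntidiagonal.antidiagonal n) (f := fun p s ↦
        W p.1 s * adPowCoeff (fun m ↦ W m s) (A s) k p.2 -
          adPowCoeff (fun m ↦ W m s) (A s) k p.2 * W p.1 s) fun p hp ↦ by
      have hp := Finset.HasAntidiagonal.mem_antidiagonal.1 hp
      have h1 := ih (n := p.2) fun m hm ↦ hW m (by omega)
      have h2 := hW p.1 (by omega)
      exact (h1.continuousOn_mul h2).sub (h1.mul_continuousOn h2)
    simpa only [Finset.sum_fn] using this

theorem hasACDeriv_magnusTerm {A : ℝ → Matrix ι ι ℝ} {t : ℝ}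
    (hA : IntervalIntegrable A volume 0 t) (n : ℕ) :
    HasACDeriv (magnusTerm A n) (magnusIntegrand A n) 0 t := by
  induction n using Nat.strong_induction_on with
  | _ n ih =>
    refine HasACDeriv.of_integral ?_ fun x ↦ ?_
    · cases n with
      | zero => exact intervalIntegrable_const
      | succ n =>
        have := IntervalIntegrable.sum (μ := volume) (a := 0) (b := t) (Finset.range (n + 1))
          (f := fun k s ↦ ((bernoulli k : ℝ) / (k.factorial : ℝ)) •
            adPowCoeff (fun m ↦ magnusTerm A m s) (A s) k n) fun k _ ↦
          (intervalIntegrable_adPowCoeff hA (n := n)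
            (fun m hm ↦ (ih m (by omega)).ac.continuousOn) k).smul
            ((bernoulli k : ℝ) / (k.factorial : ℝ))
        simp only [Finset.sum_fn] at this
        exact this
    · rw [magnusTerm_eq_integral, magnusTerm_eq_integral]
      simp

/-- The Magnus series as a formal power series. -/
noncomputable def magnusPowerSeries (A : ℝ → Matrix ι ι ℝ) (s : ℝ) : (Matrix ι ι ℝ)⟦X⟧ :=
  PowerSeries.mk fun n ↦ magnusTerm A n s

/-- The derivative of the Magnus series as a formal power series. -/
noncomputable def magnusPowerSeriesDeriv (A : ℝ → Matrix ι ι ℝ) (s : ℝ) : (Matrix ι ι ℝ)⟦X⟧ :=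
  PowerSeries.mk fun n ↦ magnusIntegrand A n s

theorem X_dvd_magnusPowerSeries (A : ℝ → Matrix ι ι ℝ) (s : ℝ) : X ∣ magnusPowerSeries A s := by
  have := (PowerSeries.X_pow_dvd_iff (n := 1) (φ := magnusPowerSeries A s)).2 fun m hm ↦ by
    obtain rfl : m = 0 := by omega
    simp [magnusPowerSeries, magnusTerm]
  simpa using this

theorem X_dvd_magnusPowerSeriesDeriv (A : ℝ → Matrix ι ι ℝ) (s : ℝ) :
    X ∣ magnusPowerSeriesDeriv A s := by
  have := (PowerSeries.X_pow_dvd_iff (n := 1) (φ := magnusPowerSeriesDeriv A s)).2 fun m hm ↦ by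
    obtain rfl : m = 0 := by omega
    simp [magnusPowerSeriesDeriv, magnusIntegrand]
  simpa using this

theorem commutatorEnd_pow_X_mul {R : Type*} [Ring R] [Algebra ℚ R] (x y : R⟦X⟧) (k : ℕ) :
    (commutatorEnd x ^ k) (X * y) = X * (commutatorEnd x ^ k) y := by
  induction k with
  | zero => simp
  | succ k ih =>
    rw [commutatorEnd_pow_succ_apply, ih, commutatorEnd_pow_succ_apply, commutatorEnd_apply,
      commutatorEnd_apply, mul_sub, mul_assoc, ← mul_assoc x, (commute_X x).eq, mul_assoc]

/-- The recursion for all `Ω_n` with `n ≤ N` as a single congruence; the formal variable `X` plays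
the role of `κ`. -/
theorem X_pow_dvd_magnusPowerSeriesDeriv_sub (A : ℝ → Matrix ι ι ℝ) (s : ℝ) (N : ℕ) :
    X ^ (N + 1) ∣ magnusPowerSeriesDeriv A s - ∑ k ∈ Finset.range N,
      coeff k (bernoulliPowerSeries ℚ) • (commutatorEnd (magnusPowerSeries A s) ^ k)
        (X * C (A s)) := by
  rw [PowerSeries.X_pow_dvd_iff]
  intro m hm
  rw [map_sub, map_sum, sub_eq_zero]
  cases m with
  | zero => simp [magnusPowerSeriesDeriv, magnusIntegrand, commutatorEnd_pow_X_mul]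
  | succ n =>
    simp only [commutatorEnd_pow_X_mul, magnusPowerSeriesDeriv, coeff_mk, magnusIntegrand]
    rw [← Finset.sum_subset (Finset.range_subset_range.2 (show n + 1 ≤ N by omega))]
    · refine Finset.sum_congr rfl fun k _ ↦ ?_
      rw [coeff_smul, coeff_succ_X_mul, coeff_commutatorEnd_pow_C]
      simp only [magnusPowerSeries, coeff_mk, bernoulliPowerSeries]
      rw [← Rat.cast_smul_eq_qsmul ℝ]
      simp
    · intro k _ hk
      rw [coeff_smul, coeff_succ_X_mul]
      -- As `Ω` has no constant term, `ad_Ω ^ k` raises the order by `k`, so the terms with `k > n`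
      -- do not contribute.
      have h1 := X_pow_dvd_commutatorEnd_pow (X_dvd_magnusPowerSeries A s) (j := 0)
        (y := C (A s)) (by simp) k
      rw [PowerSeries.X_pow_dvd_iff] at h1
      rw [h1 n (by simp at hk; omega), smul_zero]

theorem HasACDeriv.coeff_pow {B : Type*} [NormedRing B] [NormedAlgebra ℝ B] {x d : ℝ → B⟦X⟧}
    {a b : ℝ} (h : ∀ n, HasACDeriv (fun s ↦ coeff n (x s)) (fun s ↦ coeff n (d s)) a b)
    (k n : ℕ) :
    HasACDeriv (fun s ↦ coeff n (x s ^ k)) (fun s ↦ coeff n (powDeriv (x s) (d s) k)) a b := by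
  induction k generalizing n with
  | zero => simpa [powDeriv] using HasACDeriv.const _
  | succ k ih =>
    simp only [pow_succ' (x _), powDeriv, map_add, coeff_mul, ← Finset.sum_add_distrib]
    exact HasACDeriv.sum _ fun p _ ↦ (h p.1).mul (ih p.2)

/-- The terms of the Dyson series: iterated integrals of `A`. -/
noncomputable def dysonTerm (A : ℝ → Matrix ι ι ℝ) : ℕ → ℝ → Matrix ι ι ℝ
  | 0 => fun _ ↦ 1
  | n + 1 => fun t ↦ ∫ s in (0 : ℝ)..t, A s * dysonTerm A n s

/-- The almost everywhere derivative of the terms of the Dyson series. -/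
noncomputable def dysonDeriv (A : ℝ → Matrix ι ι ℝ) : ℕ → ℝ → Matrix ι ι ℝ
  | 0 => fun _ ↦ 0
  | n + 1 => fun s ↦ A s * dysonTerm A n s

theorem hasACDeriv_dysonTerm {A : ℝ → Matrix ι ι ℝ} {t : ℝ}
    (hA : IntervalIntegrable A volume 0 t) (n : ℕ) :
    HasACDeriv (dysonTerm A n) (dysonDeriv A n) 0 t := by
  induction n with
  | zero => exact HasACDeriv.const 1
  | succ n ih =>
    exact HasACDeriv.of_integral (hA.mul_continuousOn ih.ac.continuousOn)
      fun x ↦ by simp [dysonTerm, dysonDeriv]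

theorem hasACDeriv_coeff_truncExp {A : ℝ → Matrix ι ι ℝ} {t : ℝ}
    (hA : IntervalIntegrable A volume 0 t) {N n : ℕ} (hn : n ≤ N) :
    HasACDeriv (fun s ↦ coeff n (truncExp N (magnusPowerSeries A s)))
      (fun s ↦ coeff n (X * C (A s) * truncExp N (magnusPowerSeries A s))) 0 t := by
  have h (n : ℕ) : HasACDeriv (fun s ↦ coeff n (magnusPowerSeries A s))
      (fun s ↦ coeff n (magnusPowerSeriesDeriv A s)) 0 t := by
    simpa [magnusPowerSeries, magnusPowerSeriesDeriv] using hasACDeriv_magnusTerm hA n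
  have h1 := HasACDeriv.sum (Finset.range (N + 1)) fun k _ ↦
    (HasACDeriv.coeff_pow h k n).clm
      (((k.factorial : ℝ)⁻¹) • ContinuousLinearMap.id ℝ (Matrix ι ι ℝ))
  have e (k : ℕ) (y : (Matrix ι ι ℝ)⟦X⟧) : (((k.factorial : ℝ)⁻¹) •
      ContinuousLinearMap.id ℝ (Matrix ι ι ℝ)) (coeff n y) =
        coeff n (((k.factorial : ℚ)⁻¹) • y) := by
    rw [coeff_smul, ← Rat.cast_smul_eq_qsmul ℝ]
    simp
  simp only [e, ← map_sum] at h1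
  refine h1.congr (ae_of_all _ fun s _ ↦ ?_)
  have h2 := X_pow_dvd_sum_powDeriv_sub_mul_truncExp (X_dvd_magnusPowerSeries A s)
    (Dvd.intro _ rfl) (X_pow_dvd_magnusPowerSeriesDeriv_sub A s N)
    (X_dvd_magnusPowerSeriesDeriv A s)
  rw [PowerSeries.X_pow_dvd_iff] at h2
  exact sub_eq_zero.1 (by rw [← map_sub]; exact h2 n (by omega))

/-- The exponential of the Magnus series is the Dyson series, as formal power series. -/
theorem coeff_truncExp_magnusPowerSeries {A : ℝ → Matrix ι ι ℝ} {t : ℝ}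
    (hA : IntervalIntegrable A volume 0 t) {N n : ℕ} (hn : n ≤ N) {s : ℝ} (hs : s ∈ uIcc 0 t) :
    coeff n (truncExp N (magnusPowerSeries A s)) = dysonTerm A n s := by
  have h0 (n : ℕ) : coeff n (truncExp N (magnusPowerSeries A 0)) = dysonTerm A n 0 := by
    have : magnusPowerSeries A 0 = 0 := by
      ext1 n; simp [magnusPowerSeries, magnusTerm_eq_integral]
    rw [this, truncExp, Finset.sum_range_succ']
    cases n <;> simp [dysonTerm, coeff_one]
  induction n generalizing s with
  | zero =>
    refine (hasACDeriv_coeff_truncExp hA hn).eq_of_initial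
      ((hasACDeriv_dysonTerm hA 0).congr (ae_of_all _ fun s _ ↦ ?_)) (h0 0) hs
    simp [dysonDeriv, mul_assoc]
  | succ n ih =>
    refine (hasACDeriv_coeff_truncExp hA hn).eq_of_initial
      ((hasACDeriv_dysonTerm hA (n + 1)).congr (ae_of_all _ fun s hs ↦ ?_)) (h0 _) hs
    -- The factor `X` lowers the degree: the derivative in degree `n + 1` is `A s` times the
    -- coefficient of degree `n`, known by induction.
    rw [mul_assoc, coeff_succ_X_mul, coeff_C_mul, ih (by omega) hs, dysonDeriv]

end MagnusFormal

/-! ### From formal power series to functions of a small complex variable -/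

section TruncatedEvaluation

open PowerSeries Asymptotics

variable {B : Type*} [NormedRing B] [NormedAlgebra ℂ B]

/-- The value at `z` of the truncation of degree `N` of a power series. -/
noncomputable def truncEval (N : ℕ) (q : B⟦X⟧) (z : ℂ) : B :=
  ∑ n ∈ Finset.range (N + 1), z ^ n • coeff n q

theorem isBigO_pow_smul_const (n : ℕ) (b : B) :
    (fun z : ℂ ↦ z ^ n • b) =O[𝓝 0] fun z ↦ z ^ n := by
  refine IsBigO.of_bound ‖b‖ (Eventually.of_forall fun z ↦ ?_)
  rw [norm_smul, mul_comm]

theorem isBigO_pow_of_le {m n : ℕ} (h : m ≤ n) :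
    (fun z : ℂ ↦ z ^ n) =O[𝓝 0] fun z ↦ z ^ m := by
  refine IsBigO.of_bound 1 ?_
  filter_upwards [Metric.ball_mem_nhds (0 : ℂ) one_pos] with z hz
  rw [norm_pow, norm_pow, one_mul]
  exact pow_le_pow_of_le_one (norm_nonneg _) (mem_ball_zero_iff.1 hz).le h

theorem isBigO_truncEval_one (N : ℕ) (q : B⟦X⟧) :
    truncEval N q =O[𝓝 0] fun _ ↦ (1 : ℂ) := by
  unfold truncEval
  refine IsBigO.fun_sum fun n _ ↦ (isBigO_pow_smul_const n _).trans ?_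
  simpa using isBigO_pow_of_le (Nat.zero_le n)

theorem isBigO_truncEval_id (N : ℕ) {q : B⟦X⟧} (hq : X ∣ q) :
    truncEval N q =O[𝓝 0] fun z ↦ z := by
  unfold truncEval
  refine IsBigO.fun_sum fun n _ ↦ ?_
  cases n with
  | zero =>
    have : coeff 0 q = 0 := (PowerSeries.X_pow_dvd_iff (n := 1)).1 (by simpa using hq) 0 one_pos
    simpa [this] using isBigO_zero _ _
  | succ n =>
    refine (isBigO_pow_smul_const (n + 1) _).trans ?_
    simpa using isBigO_pow_of_le (show 1 ≤ n + 1 by omega)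

theorem isBigO_truncEval_mul_sub (N : ℕ) (p q : B⟦X⟧) :
    (fun z ↦ truncEval N p z * truncEval N q z - truncEval N (p * q) z) =O[𝓝 0]
      fun z ↦ z ^ (N + 1) := by
  have e (z : ℂ) : truncEval N p z * truncEval N q z - truncEval N (p * q) z =
      ∑ m ∈ Finset.range (N + 1), ∑ l ∈ Finset.Ico (N + 1 - m) (N + 1),
        z ^ (m + l) • (coeff m p * coeff l q) := by
    have h1 : truncEval N (p * q) z = ∑ m ∈ Finset.range (N + 1),
        ∑ l ∈ Finset.range (N + 1 - m), z ^ (m + l) • (coeff m p * coeff l q) := by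
      rw [← Finset.sum_range_diag_flip (N + 1) fun m l ↦ z ^ (m + l) • (coeff m p * coeff l q)]
      refine Finset.sum_congr rfl fun n _ ↦ ?_
      rw [coeff_mul, Finset.Nat.sum_antidiagonal_eq_sum_range_succ_mk, Finset.smul_sum]
      refine Finset.sum_congr rfl fun m hm ↦ ?_
      rw [Nat.add_sub_cancel' (by simpa [Nat.lt_succ_iff] using hm)]
    rw [h1, truncEval, truncEval, Finset.sum_mul_sum, ← Finset.sum_sub_distrib]
    refine Finset.sum_congr rfl fun m _ ↦ ?_
    rw [Finset.sum_Ico_eq_sub _ (by omega)]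
    simp only [smul_mul_smul_comm, pow_add]
  simp only [e]
  refine IsBigO.fun_sum fun m _ ↦ IsBigO.fun_sum fun l hl ↦ ?_
  have := Finset.mem_Ico.1 hl
  exact (isBigO_pow_smul_const _ _).trans (isBigO_pow_of_le (by omega))

theorem isBigO_truncEval_pow_sub (N : ℕ) (q : B⟦X⟧) (k : ℕ) :
    (fun z ↦ truncEval N q z ^ k - truncEval N (q ^ k) z) =O[𝓝 0] fun z ↦ z ^ (N + 1) := by
  induction k with
  | zero =>
    have (z : ℂ) : truncEval N (1 : B⟦X⟧) z = 1 := by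
      simp [truncEval, coeff_one]
    simpa [this] using isBigO_zero _ _
  | succ k ih =>
    have h0 := ih.mul (isBigO_truncEval_one N q)
    simp only [mul_one] at h0
    have h1 := h0.add (isBigO_truncEval_mul_sub N (q ^ k) q)
    simpa [pow_succ _ k, sub_mul] using h1

theorem isBigO_sub_truncEval_of_hasSum (N : ℕ) {q : B⟦X⟧} {f : ℂ → B}
    (hq : Summable fun n ↦ ‖coeff n q‖)
    (hf : ∀ z : ℂ, ‖z‖ ≤ 1 → HasSum (fun n ↦ z ^ n • coeff n q) (f z)) :
    (fun z ↦ f z - truncEval N q z) =O[𝓝 0] fun z ↦ z ^ (N + 1) := by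
  refine IsBigO.of_bound (∑' n, ‖coeff (n + (N + 1)) q‖) ?_
  filter_upwards [Metric.ball_mem_nhds (0 : ℂ) one_pos] with z hz
  have hz1 : ‖z‖ ≤ 1 := (mem_ball_zero_iff.1 hz).le
  have h1 := (hasSum_nat_add_iff' (N + 1)).2 (hf z hz1)
  have h2 := (summable_nat_add_iff (N + 1)).2 hq
  rw [truncEval, ← h1.tsum_eq, ← tsum_mul_right]
  refine tsum_of_norm_bounded (h2.mul_right _).hasSum fun n ↦ ?_
  rw [norm_smul, mul_comm, norm_pow, norm_pow]
  gcongr ?_ * ?_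
  exact pow_le_pow_of_le_one (norm_nonneg _) hz1 (by omega)

/-- Once the coefficients below `n` agree, the case `N = n` reads `z ^ n • (pₙ - qₙ) = O(z ^ (n +
1))`; divide by `z ^ n` and let `z → 0`. -/
theorem coeff_eq_of_isBigO {p q : B⟦X⟧}
    (h : ∀ N, (fun z ↦ truncEval N p z - truncEval N q z) =O[𝓝 0] fun z : ℂ ↦ z ^ (N + 1)) :
    p = q := by
  ext1 n
  induction n using Nat.strong_induction_on with
  | _ n ih =>
    have e (z : ℂ) : truncEval n p z - truncEval n q z = z ^ n • (coeff n p - coeff n q) := by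
      rw [truncEval, truncEval, Finset.sum_range_succ, Finset.sum_range_succ,
        Finset.sum_congr rfl fun m hm ↦ by rw [ih m (Finset.mem_range.1 hm)]]
      rw [smul_sub]; abel
    have h1 := h n
    simp only [e] at h1
    obtain ⟨C, hC⟩ := h1.bound
    have h2 : ∀ᶠ z : ℂ in 𝓝[≠] 0, ‖coeff n p - coeff n q‖ ≤ C * ‖z‖ := by
      filter_upwards [hC.filter_mono nhdsWithin_le_nhds, self_mem_nhdsWithin] with z hz hz0
      rw [norm_smul, norm_pow, norm_pow, pow_succ, mul_left_comm] at hz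
      exact le_of_mul_le_mul_left hz (pow_pos (norm_pos_iff.2 hz0) n)
    have h3 : Tendsto (fun z : ℂ ↦ C * ‖z‖) (𝓝[≠] 0) (𝓝 (C * ‖(0 : ℂ)‖)) :=
      ((continuous_const.mul continuous_norm).tendsto 0).mono_left nhdsWithin_le_nhds
    have h4 := ge_of_tendsto h3 h2
    rw [norm_zero, mul_zero] at h4
    exact sub_eq_zero.1 (norm_le_zero_iff.1 h4)

variable [CompleteSpace B]

theorem isBigO_exp_sub_sum (N : ℕ) :
    (fun w : B ↦ NormedSpace.exp w - ∑ k ∈ Finset.range (N + 1), (k.factorial : ℂ)⁻¹ • w ^ k)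
      =O[𝓝 0] fun w ↦ ‖w‖ ^ (N + 1) := by
  have h := (NormedSpace.exp_hasFPowerSeriesAt_zero (𝕂 := ℂ) (𝔸 := B)).isBigO_sub_partialSum_pow
    (N + 1)
  simp only [zero_add, FormalMultilinearSeries.partialSum,
    NormedSpace.expSeries_apply_eq] at h
  refine h.congr_left fun w ↦ ?_
  rfl

theorem isBigO_exp_truncEval_sub [Algebra ℚ B] (N : ℕ) {q : B⟦X⟧} (hq : X ∣ q) :
    (fun z ↦ NormedSpace.exp (truncEval N q z) - truncEval N (truncExp N q) z) =O[𝓝 0]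
      fun z ↦ z ^ (N + 1) := by
  have hid := isBigO_truncEval_id N hq
  have ht : Tendsto (truncEval N q) (𝓝 0) (𝓝 0) := hid.trans_tendsto tendsto_id
  have h1 := (isBigO_exp_sub_sum (B := B) N).comp_tendsto ht
  have h2 : (fun z ↦ ‖truncEval N q z‖ ^ (N + 1)) =O[𝓝 0] fun z ↦ z ^ (N + 1) :=
    hid.norm_left.pow _
  have h3 : (fun z ↦ ∑ k ∈ Finset.range (N + 1), (k.factorial : ℂ)⁻¹ •
      (truncEval N q z ^ k - truncEval N (q ^ k) z)) =O[𝓝 0] fun z ↦ z ^ (N + 1) := by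
    refine IsBigO.fun_sum fun k _ ↦ ?_
    exact (isBigO_truncEval_pow_sub N q k).const_smul_left ((k.factorial : ℂ)⁻¹)
  refine ((h1.trans h2).add h3).congr_left fun z ↦ ?_
  have h4 : truncEval N (truncExp N q) z =
      ∑ k ∈ Finset.range (N + 1), (k.factorial : ℂ)⁻¹ • truncEval N (q ^ k) z := by
    simp only [truncEval, truncExp, map_sum, Finset.smul_sum]
    rw [Finset.sum_comm]
    refine Finset.sum_congr rfl fun n _ ↦ Finset.sum_congr rfl fun k _ ↦ ?_
    rw [coeff_smul, ← Rat.cast_smul_eq_qsmul ℂ, smul_comm]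
    simp
  simp [h4, smul_sub]

/-- The strict derivative of `exp` at 0 is the identity, so `exp u - exp v = (u - v) + o(u - v)`. -/
theorem isBigO_sub_of_exp {u v : ℂ → B} (hu : Tendsto u (𝓝 0) (𝓝 0))
    (hv : Tendsto v (𝓝 0) (𝓝 0)) :
    (fun z ↦ u z - v z) =O[𝓝 0] fun z ↦ NormedSpace.exp (u z) - NormedSpace.exp (v z) := by
  have h := (hasStrictFDerivAt_exp_zero (𝕂 := ℂ) (𝔸 := B)).isLittleO
  have h1 := (h.comp_tendsto (hu.prodMk_nhds hv)).right_isBigO_add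
  simpa [Function.comp_def] using h1

end TruncatedEvaluation

/-! ### Real matrices as operators on complex Euclidean space -/

section Complexification

variable {ι : Type*} [Fintype ι] [DecidableEq ι]

/-- The bounded operators on a complex inner product space. The abbreviation makes the topology of
`EuclideanSpace ℂ ι` be found through its norm. -/
abbrev BoundedEnd (H : Type*) [NormedAddCommGroup H] [InnerProductSpace ℂ H] := H →L[ℂ] H

/-- The action of a real matrix on the complex Euclidean space. -/
noncomputable def complexifyRingHom :
    Matrix ι ι ℝ →+* BoundedEnd (EuclideanSpace ℂ ι) :=
  (Matrix.toEuclideanCLM (n := ι) (𝕜 := ℂ) : _ →+* _).comp Complex.ofRealHom.mapMatrix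

theorem complexifyRingHom_apply (M : Matrix ι ι ℝ) (v : EuclideanSpace ℂ ι) (i : ι) :
    complexifyRingHom M v i = ∑ j, (M i j : ℂ) * v j := rfl

theorem complexifyRingHom_injective : Function.Injective (complexifyRingHom (ι := ι)) := by
  intro M M' h
  have h1 := (Matrix.toEuclideanCLM (n := ι) (𝕜 := ℂ)).injective h
  ext i j
  have h2 := congrFun (congrFun h1 i) j
  simpa using h2

theorem complexifyRingHom_smul (r : ℝ) (M : Matrix ι ι ℝ) :
    complexifyRingHom (r • M) = (r : ℂ) • complexifyRingHom M := by
  ext v i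
  change complexifyRingHom (r • M) v i = (r : ℂ) * complexifyRingHom M v i
  simp [complexifyRingHom_apply, Finset.mul_sum, mul_assoc]

/-- A real matrix acts separately on the real and imaginary parts of a vector, whose squared norms
add up. -/
theorem norm_complexifyRingHom_le (M : Matrix ι ι ℝ) : ‖complexifyRingHom M‖ ≤ ‖M‖ := by
  refine ContinuousLinearMap.opNorm_le_bound _ (norm_nonneg _) fun v ↦ ?_
  set x : EuclideanSpace ℝ ι := WithLp.toLp 2 fun i ↦ (v i).re with hx
  set y : EuclideanSpace ℝ ι := WithLp.toLp 2 fun i ↦ (v i).im with hy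
  have hsplit (w : EuclideanSpace ℂ ι) :
      ‖w‖ ^ 2 = ‖(WithLp.toLp 2 fun i ↦ (w i).re : EuclideanSpace ℝ ι)‖ ^ 2 +
        ‖(WithLp.toLp 2 fun i ↦ (w i).im : EuclideanSpace ℝ ι)‖ ^ 2 := by
    rw [EuclideanSpace.norm_sq_eq, EuclideanSpace.norm_sq_eq, EuclideanSpace.norm_sq_eq,
      ← Finset.sum_add_distrib]
    refine Finset.sum_congr rfl fun i _ ↦ ?_
    rw [Complex.sq_norm, Complex.normSq_apply]
    simp [sq]
  have h1 := M.l2_opNorm_mulVec x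
  have h2 := M.l2_opNorm_mulVec y
  have e1 : (WithLp.toLp 2 fun i ↦ (complexifyRingHom M v i).re : EuclideanSpace ℝ ι) =
      (EuclideanSpace.equiv ι ℝ).symm (M.mulVec x) := by
    ext i
    simp [complexifyRingHom_apply, Matrix.mulVec, dotProduct, hx]
  have e2 : (WithLp.toLp 2 fun i ↦ (complexifyRingHom M v i).im : EuclideanSpace ℝ ι) =
      (EuclideanSpace.equiv ι ℝ).symm (M.mulVec y) := by
    ext i
    simp [complexifyRingHom_apply, Matrix.mulVec, dotProduct, hy]
  refine le_of_sq_le_sq ?_ (by positivity)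
  rw [hsplit, e1, e2, mul_pow, hsplit v, mul_add, ← mul_pow, ← mul_pow]
  gcongr

end Complexification

/-! ### Convergence of the Dyson series and its integral equation -/

section Dyson

variable {ι : Type*} [Fintype ι] [DecidableEq ι]

/-- With `a s = ∫₀ˢ ‖A‖`, the function `a ^ (n + 1) / (n + 1)!` is a primitive of `‖A‖ a ^ n / n!`.
The factor `‖1‖` allows for an empty index type. -/
theorem norm_dysonTerm_le {A : ℝ → Matrix ι ι ℝ} {t : ℝ} (ht : 0 ≤ t)
    (hA : IntervalIntegrable A volume 0 t) (n : ℕ) {s : ℝ} (hs : s ∈ Icc 0 t) :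
    ‖dysonTerm A n s‖ ≤
      ‖(1 : Matrix ι ι ℝ)‖ * ((n.factorial : ℝ)⁻¹ * (∫ τ in (0 : ℝ)..s, ‖A τ‖) ^ n) := by
  set a : ℝ → ℝ := fun s ↦ ∫ τ in (0 : ℝ)..s, ‖A τ‖ with ha
  have haD : HasACDeriv a (fun s ↦ ‖A s‖) 0 t := HasACDeriv.of_integral hA.norm (by simp [ha])
  induction n generalizing s with
  | zero => simp [dysonTerm]
  | succ n ih =>
    have hs' : uIcc 0 s ⊆ uIcc 0 t := by
      rw [uIcc_of_le hs.1, uIcc_of_le ht]; exact Icc_subset_Icc_right hs.2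
    have hφ : ContDiff ℝ 1 fun x : ℝ ↦
      ‖(1 : Matrix ι ι ℝ)‖ * (((n + 1).factorial : ℝ)⁻¹ * x ^ (n + 1)) := by fun_prop
    have hd : HasACDeriv
        (fun s ↦ ‖(1 : Matrix ι ι ℝ)‖ * (((n + 1).factorial : ℝ)⁻¹ * a s ^ (n + 1)))
        (fun s ↦ ‖A s‖ * (‖(1 : Matrix ι ι ℝ)‖ * ((n.factorial : ℝ)⁻¹ * a s ^ n))) 0 s := by
      refine ((haD.mono hs').comp_contDiff hφ).congr (ae_of_all _ fun x _ ↦ ?_)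
      have h1 : HasDerivAt (fun x : ℝ ↦
          ‖(1 : Matrix ι ι ℝ)‖ * (((n + 1).factorial : ℝ)⁻¹ * x ^ (n + 1))) _ (a x) :=
        ((hasDerivAt_pow (n + 1) (a x)).const_mul _).const_mul _
      rw [h1.hasFDerivAt.fderiv, Nat.factorial_succ]
      simp only [ContinuousLinearMap.toSpanSingleton_apply, smul_eq_mul, Nat.add_sub_cancel]
      have := Nat.factorial_ne_zero n
      push_cast
      field_simp
    have h2 := hd.integral_eq hd.intervalIntegrable_real
    have ha0 : a 0 = 0 := intervalIntegral.integral_same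
    rw [ha0, zero_pow (Nat.succ_ne_zero n), mul_zero, mul_zero, sub_zero] at h2
    rw [← h2]
    refine intervalIntegral.norm_integral_le_of_norm_le hs.1 (ae_of_all _ fun x hx ↦ ?_)
      hd.intervalIntegrable_real
    refine (norm_mul_le _ _).trans (mul_le_mul_of_nonneg_left ?_ (norm_nonneg _))
    exact ih ⟨hx.1.le, hx.2.trans hs.2⟩

variable {B : Type*} [NormedRing B] [NormedAlgebra ℂ B] (Φ : Matrix ι ι ℝ →ₐ[ℝ] B)

/-- The sum of the Dyson series of `z • A`. -/
noncomputable def dysonSum (A : ℝ → Matrix ι ι ℝ) (z : ℂ) (s : ℝ) : B :=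
  ∑' n, z ^ n • Φ (dysonTerm A n s)

theorem dysonSum_zero (A : ℝ → Matrix ι ι ℝ) (s : ℝ) : dysonSum Φ A 0 s = 1 := by
  rw [dysonSum, tsum_eq_single 0 fun n hn ↦ by simp [hn]]
  simp [dysonTerm]

/-- A summable majorant of the Dyson series on `[0, t]`, for parameters of norm at most `r`. -/
noncomputable def dysonBound (A : ℝ → Matrix ι ι ℝ) (t r : ℝ) (n : ℕ) : ℝ :=
  ‖(1 : Matrix ι ι ℝ)‖ * ((n.factorial : ℝ)⁻¹ * (r * ∫ τ in (0 : ℝ)..t, ‖A τ‖) ^ n)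

theorem summable_dysonBound (A : ℝ → Matrix ι ι ℝ) (t r : ℝ) : Summable (dysonBound A t r) := by
  refine Summable.mul_left _ ?_
  simpa [div_eq_inv_mul] using Real.summable_pow_div_factorial (r * ∫ τ in (0 : ℝ)..t, ‖A τ‖)

variable {A : ℝ → Matrix ι ι ℝ} {t : ℝ} {Φ}

theorem norm_dysonSum_term_le (hΦ : ∀ M, ‖Φ M‖ ≤ ‖M‖) (ht : 0 ≤ t) (hA : IntervalIntegrable A volume 0 t) {z : ℂ} {r : ℝ}
    (hz : ‖z‖ ≤ r) (n : ℕ) {s : ℝ} (hs : s ∈ Icc 0 t) :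
    ‖z ^ n • Φ (dysonTerm A n s)‖ ≤ dysonBound A t r n := by
  have h1 := norm_dysonTerm_le ht hA n hs
  have h2 : ∫ τ in (0 : ℝ)..s, ‖A τ‖ ≤ ∫ τ in (0 : ℝ)..t, ‖A τ‖ :=
    intervalIntegral.integral_mono_interval le_rfl hs.1 hs.2
      (ae_of_all _ fun _ ↦ norm_nonneg _) hA.norm
  have h0 : 0 ≤ ∫ τ in (0 : ℝ)..s, ‖A τ‖ :=
    intervalIntegral.integral_nonneg hs.1 fun _ _ ↦ norm_nonneg _
  rw [norm_smul, norm_pow, dysonBound, mul_pow]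
  calc ‖z‖ ^ n * ‖Φ (dysonTerm A n s)‖
      ≤ r ^ n * (‖(1 : Matrix ι ι ℝ)‖ *
        ((n.factorial : ℝ)⁻¹ * (∫ τ in (0 : ℝ)..t, ‖A τ‖) ^ n)) := by
        refine mul_le_mul (pow_le_pow_left₀ (norm_nonneg _) hz n) ?_ (norm_nonneg _)
          (pow_nonneg ((norm_nonneg z).trans hz) n)
        exact (hΦ _).trans (h1.trans (by gcongr))
    _ = _ := by ring

variable [CompleteSpace B]

theorem hasSum_dysonSum (hΦ : ∀ M, ‖Φ M‖ ≤ ‖M‖) (ht : 0 ≤ t) (hA : IntervalIntegrable A volume 0 t) (z : ℂ) {s : ℝ}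
    (hs : s ∈ Icc 0 t) :
    HasSum (fun n ↦ z ^ n • Φ (dysonTerm A n s)) (dysonSum Φ A z s) :=
  (Summable.of_norm_bounded (summable_dysonBound A t ‖z‖)
    fun n ↦ norm_dysonSum_term_le hΦ ht hA le_rfl n hs).hasSum

theorem differentiable_dysonSum (hΦ : ∀ M, ‖Φ M‖ ≤ ‖M‖) (ht : 0 ≤ t) (hA : IntervalIntegrable A volume 0 t) {s : ℝ}
    (hs : s ∈ Icc 0 t) : Differentiable ℂ fun z ↦ dysonSum Φ A z s := by
  intro z
  refine (Complex.differentiableOn_tsum_of_summable_norm (U := Metric.ball 0 (‖z‖ + 1))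
    (F := fun n z ↦ z ^ n • Φ (dysonTerm A n s))
    (summable_dysonBound A t (‖z‖ + 1)) (fun n ↦ by fun_prop) Metric.isOpen_ball
    fun n w hw ↦ norm_dysonSum_term_le hΦ ht hA (mem_ball_zero_iff.1 hw).le n hs).differentiableAt
    (Metric.isOpen_ball.mem_nhds (by simp))

theorem continuousOn_dysonSum (hΦ : ∀ M, ‖Φ M‖ ≤ ‖M‖) (ht : 0 ≤ t) (hA : IntervalIntegrable A volume 0 t) (z : ℂ) :
    ContinuousOn (dysonSum Φ A z) (uIcc 0 t) := by
  refine continuousOn_tsum (fun n ↦ ?_) (summable_dysonBound A t ‖z‖) fun n s hs ↦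
    norm_dysonSum_term_le hΦ ht hA le_rfl n (by rwa [uIcc_of_le ht] at hs)
  exact ((Φ.toLinearMap.mkContinuous 1 (by simpa using hΦ)).continuous.comp_continuousOn
    (hasACDeriv_dysonTerm hA n).ac.continuousOn).const_smul (z ^ n)

theorem dysonSum_eq_integral (hΦ : ∀ M, ‖Φ M‖ ≤ ‖M‖) (ht : 0 ≤ t) (hA : IntervalIntegrable A volume 0 t) (z : ℂ) {s : ℝ}
    (hs : s ∈ Icc 0 t) :
    dysonSum Φ A z s = 1 + ∫ τ in (0 : ℝ)..s, z • (Φ (A τ) * dysonSum Φ A z τ) := by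
  have hs' : uIcc 0 s ⊆ uIcc 0 t := by
    rw [uIcc_of_le hs.1, uIcc_of_le ht]; exact Icc_subset_Icc_right hs.2
  have hmem {τ : ℝ} (hτ : τ ∈ uIoc 0 s) : τ ∈ Icc 0 t := by
    have := hs' (uIoc_subset_uIcc hτ)
    rwa [uIcc_of_le ht] at this
  have hAs := hA.mono_set hs'
  set Ψ : Matrix ι ι ℝ →L[ℝ] B := Φ.toLinearMap.mkContinuous 1 (by simpa using hΦ)
  have hint (n : ℕ) : IntervalIntegrable (fun τ ↦ A τ * dysonTerm A n τ) volume 0 s :=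
    hAs.mul_continuousOn ((hasACDeriv_dysonTerm hA n).ac.continuousOn.mono hs')
  have hintC (n : ℕ) : IntervalIntegrable
      (fun τ ↦ Φ (A τ * dysonTerm A n τ)) volume 0 s :=
    ⟨Ψ.integrable_comp (hint n).1, Ψ.integrable_comp (hint n).2⟩
  have h1 : HasSum
      (fun n ↦ ∫ τ in (0 : ℝ)..s, z ^ (n + 1) • Φ (A τ * dysonTerm A n τ))
      (∫ τ in (0 : ℝ)..s, z • (Φ (A τ) * dysonSum Φ A z τ)) := by
    refine intervalIntegral.hasSum_integral_of_dominated_convergence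
      (fun n τ ↦ ‖z‖ * ‖A τ‖ * dysonBound A t ‖z‖ n) (fun n ↦ ?_) (fun n ↦ ?_) ?_ ?_ ?_
    · exact ((intervalIntegrable_iff.1 (hintC n)).aestronglyMeasurable ).const_smul (z ^ (n + 1))
    · refine ae_of_all _ fun τ hτ ↦ ?_
      have h2 := norm_dysonSum_term_le hΦ ht hA (le_refl ‖z‖) n (hmem hτ)
      rw [map_mul, pow_succ', mul_smul, ← mul_smul_comm, norm_smul, mul_assoc]
      refine mul_le_mul_of_nonneg_left ((norm_mul_le _ _).trans ?_) (norm_nonneg _)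
      exact mul_le_mul (hΦ _) h2 (norm_nonneg _) (norm_nonneg _)
    · exact ae_of_all _ fun τ _ ↦ (summable_dysonBound A t ‖z‖).mul_left _
    · simp only [tsum_mul_left]
      exact (hAs.norm.const_mul _).mul_const _
    · refine ae_of_all _ fun τ hτ ↦ ?_
      have h2 := ((hasSum_dysonSum hΦ ht hA z (hmem hτ)).mul_left (Φ (A τ))).const_smul z
      refine h2.congr_fun fun n ↦ ?_
      rw [map_mul, pow_succ', mul_smul, mul_smul_comm]
  have h3 := hasSum_dysonSum hΦ ht hA z hs
  have h4 := (hasSum_nat_add_iff' 1).2 h3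
  simp only [Finset.sum_range_one, pow_zero, one_smul, dysonTerm, map_one] at h4
  have h5 (n : ℕ) : ∫ τ in (0 : ℝ)..s, z ^ (n + 1) • Φ (A τ * dysonTerm A n τ) =
      z ^ (n + 1) • Φ (∫ τ in (0 : ℝ)..s, A τ * dysonTerm A n τ) := by
    rw [intervalIntegral.integral_smul]
    congr 1
    exact Ψ.intervalIntegral_comp_comm (hint n)
  simp only [h5] at h1
  rw [← sub_eq_iff_eq_add']
  exact h4.unique h1

end Dyson

/-! ### The evolution operator, its logarithm and the Magnus series -/

section Evolution

variable {ι : Type*} [Fintype ι] [DecidableEq ι] {H : Type*} [NormedAddCommGroup H]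
  [InnerProductSpace ℂ H]
  {Φ : Matrix ι ι ℝ →ₐ[ℝ] (H →L[ℂ] H)} {A : ℝ → Matrix ι ι ℝ} {t : ℝ}

theorem norm_smul_apply_le (hΦ : ∀ M, ‖Φ M‖ ≤ ‖M‖) (M : Matrix ι ι ℝ) (z : ℂ) (v : H) :
    ‖z • Φ M v‖ ≤ ‖z‖ * ‖M‖ * ‖v‖ := by
  rw [norm_smul, mul_assoc]
  gcongr
  exact ((Φ M).le_opNorm v).trans (by gcongr; exact hΦ M)

variable [CompleteSpace H]

/-- Each orbit of the sum of the Dyson series solves the differential equation. -/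
theorem exists_hasACDeriv_dysonSum_apply (hΦ : ∀ M, ‖Φ M‖ ≤ ‖M‖) (ht : 0 ≤ t)
    (hA : IntervalIntegrable A volume 0 t) (z : ℂ) (v : H) :
    ∃ y : ℝ → H, HasACDeriv y (fun s ↦ z • Φ (A s) (y s)) 0 t ∧
      ∀ s ∈ Icc 0 t, y s = dysonSum Φ A z s v := by
  -- The integral equation for the Dyson sum is known only on `[0, t]`; `W` is given by the integral
  -- on the whole line, as `HasACDeriv.of_integral` requires.
  set W : ℝ → H →L[ℂ] H := fun s ↦ 1 + ∫ τ in (0 : ℝ)..s, z • (Φ (A τ) * dysonSum Φ A z τ)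
  have hW (s : ℝ) (hs : s ∈ Icc 0 t) : W s = dysonSum Φ A z s :=
    (dysonSum_eq_integral hΦ ht hA z hs).symm
  set Ψ : Matrix ι ι ℝ →L[ℝ] (H →L[ℂ] H) := Φ.toLinearMap.mkContinuous 1 (by simpa using hΦ)
  have hΦA : IntervalIntegrable (fun τ ↦ Φ (A τ)) volume 0 t :=
    ⟨Ψ.integrable_comp hA.1, Ψ.integrable_comp hA.2⟩
  have hint : IntervalIntegrable (fun τ ↦ z • (Φ (A τ) * dysonSum Φ A z τ)) volume 0 t :=
    (hΦA.mul_continuousOn (continuousOn_dysonSum hΦ ht hA z)).smul z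
  have h1 : HasACDeriv W (fun τ ↦ z • (Φ (A τ) * dysonSum Φ A z τ)) 0 t :=
    HasACDeriv.of_integral hint fun s ↦ by simp [W]
  refine ⟨fun s ↦ W s v, ?_, fun s hs ↦ congrArg (· v) (hW s hs)⟩
  refine (h1.clm ((ContinuousLinearMap.apply ℂ H v).restrictScalars ℝ)).congr
    (ae_of_all _ fun s hs ↦ ?_)
  rw [uIcc_of_le ht] at hs
  change (z • (Φ (A s) * dysonSum Φ A z s)) v = z • Φ (A s) (W s v)
  rw [hW s hs]
  rfl

/-- The segment from the identity to the evolution operator consists of invertible operators. -/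
theorem isUnit_segment_dysonSum [FiniteDimensional ℂ H] (hΦ : ∀ M, ‖Φ M‖ ≤ ‖M‖) (ht : 0 ≤ t)
    (hA : IntervalIntegrable A volume 0 t) {z : ℂ}
    (hz : ‖z‖ * ∫ τ in (0 : ℝ)..t, ‖A τ‖ < Real.pi) {u : ℝ} (hu : u ∈ Icc (0 : ℝ) 1) :
    IsUnit (1 + u • (dysonSum Φ A z t - 1)) := by
  rw [ContinuousLinearMap.isUnit_iff_isUnit_toLinearMap, LinearMap.isUnit_iff_ker_eq_bot,
    LinearMap.ker_eq_bot']
  intro v hv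
  by_contra hv0
  have hv : v + u • (dysonSum Φ A z t v - v) = 0 := hv
  obtain ⟨y, hy, hyD⟩ := exists_hasACDeriv_dysonSum_apply hΦ ht hA z v
  have : FiniteDimensional ℝ H := FiniteDimensional.complexToReal H
  let _ : InnerProductSpace ℝ H := InnerProductSpace.complexToReal
  have hρ : IntervalIntegrable (fun s ↦ ‖z‖ * ‖A s‖) volume 0 t := hA.norm.const_mul _
  have hle : ∀ᵐ s : ℝ, s ∈ uIcc 0 t → ‖z • Φ (A s) (y s)‖ ≤ ‖z‖ * ‖A s‖ * ‖y s‖ :=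
    ae_of_all _ fun s _ ↦ norm_smul_apply_le hΦ _ _ _
  have hy0 : y 0 = v := by
    rw [hyD 0 ⟨le_rfl, ht⟩, dysonSum_eq_integral hΦ ht hA z ⟨le_rfl, ht⟩]
    simp
  rw [← hyD t ⟨ht, le_rfl⟩] at hv
  rcases hu.1.eq_or_lt with rfl | hu0
  · simp at hv; exact hv0 hv
  -- A kernel vector `v` is the start of an orbit ending at a nonpositive multiple of `v`. For `u =
  -- 1` the orbit would vanish at `t`; for `u < 1` it would have turned by π.
  have hyt : y t = -(((1 - u) / u) • y 0) := by
    rw [hy0]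
    have h2 : u • y t = u • -(((1 - u) / u) • v) := by
      rw [smul_neg, smul_smul, mul_div_cancel₀ _ hu0.ne', sub_smul, one_smul]
      rw [smul_sub] at hv
      rw [← sub_eq_zero, ← hv]
      abel
    exact smul_right_injective H hu0.ne' h2
  rcases hu.2.eq_or_lt with rfl | hu1
  · rw [sub_self, zero_div, zero_smul, neg_zero,
      hy.eq_zero_iff ht hρ (fun s ↦ by positivity) hle, hy0] at hyt
    exact hv0 hyt
  · exact hy.ne_neg_smul ht hρ (fun s ↦ by positivity) hle
      (by rwa [intervalIntegral.integral_const_mul]) (by rwa [hy0])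
      (div_pos (sub_pos.2 hu1) hu0) hyt

/-- The sum of the Dyson series is the fundamental solution. -/
theorem dysonSum_one_eq [FiniteDimensional ℂ H] (hΦ : ∀ M, ‖Φ M‖ ≤ ‖M‖) (ht : 0 ≤ t)
    (hA : IntervalIntegrable A volume 0 t) {Y : ℝ → Matrix ι ι ℝ}
    (hY : IsFundamentalSolution A Y t) : dysonSum Φ A 1 t = Φ (Y t) := by
  ext v
  obtain ⟨y, hy, hyD⟩ := exists_hasACDeriv_dysonSum_apply hΦ ht hA 1 v
  have : FiniteDimensional ℝ H := FiniteDimensional.complexToReal H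
  let _ : InnerProductSpace ℝ H := InnerProductSpace.complexToReal
  set Ψ : Matrix ι ι ℝ →L[ℝ] (H →L[ℂ] H) := Φ.toLinearMap.mkContinuous 1 (by simpa using hΦ)
  have hY1 : HasACDeriv Y (fun s ↦ A s * Y s) 0 t := by
    refine ⟨hY.absolutelyContinuous, ?_⟩
    have h0 : ∀ᵐ s : ℝ, s ≠ 0 := by simp [ae_iff, measure_singleton]
    have h1 : ∀ᵐ s : ℝ, s ≠ t := by simp [ae_iff, measure_singleton]
    filter_upwards [hY.ode, h0, h1] with s hs hs0 hst hmem
    rw [uIcc_of_le ht] at hmem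
    exact hs ⟨lt_of_le_of_ne hmem.1 hs0.symm, lt_of_le_of_ne hmem.2 hst⟩
  have hY2 : HasACDeriv (fun s ↦ Φ (Y s) v) (fun s ↦ Φ (A s) (Φ (Y s) v)) 0 t := by
    refine (hY1.clm (((ContinuousLinearMap.apply ℂ H v).restrictScalars ℝ).comp Ψ)).congr
      (ae_of_all _ fun s _ ↦ ?_)
    change Φ (A s * Y s) v = _
    rw [map_mul]; rfl
  have hd := hy.sub hY2
  have hle : ∀ᵐ s : ℝ, s ∈ uIcc 0 t →
      ‖(1 : ℂ) • Φ (A s) (y s) - Φ (A s) (Φ (Y s) v)‖ ≤ ‖A s‖ * ‖y s - Φ (Y s) v‖ := by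
    refine ae_of_all _ fun s _ ↦ ?_
    rw [one_smul, ← map_sub]
    exact ((Φ (A s)).le_opNorm _).trans (by gcongr; exact hΦ _)
  have h0 : y 0 - Φ (Y 0) v = 0 := by
    rw [hyD 0 ⟨le_rfl, ht⟩, dysonSum_eq_integral hΦ ht hA 1 ⟨le_rfl, ht⟩, hY.initial]
    simp
  have h1 := (hd.eq_zero_iff ht hA.norm (fun s ↦ norm_nonneg _) hle).2 h0
  rw [← hyD t ⟨ht, le_rfl⟩]
  exact sub_eq_zero.1 h1

open PowerSeries in
/-- Near the origin, the exponential of the truncated Magnus series agrees with the evolution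
operator up to the order of the truncation. -/
theorem isBigO_exp_magnus_sub_dysonSum (hΦ : ∀ M, ‖Φ M‖ ≤ ‖M‖) (ht : 0 ≤ t)
    (hA : IntervalIntegrable A volume 0 t) (N : ℕ) :
    (fun z : ℂ ↦ NormedSpace.exp
      (truncEval N (PowerSeries.map Φ.toRingHom (magnusPowerSeries A t)) z) -
        dysonSum Φ A z t) =O[𝓝 0] fun z ↦ z ^ (N + 1) := by
  let _ : Algebra ℚ (H →L[ℂ] H) := (NormedAlgebra.restrictScalars ℚ ℂ (H →L[ℂ] H)).toAlgebra
  set φ := Φ.toRingHom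
  have hX : X ∣ PowerSeries.map φ (magnusPowerSeries A t) := by
    simpa using map_dvd (PowerSeries.map φ) (X_dvd_magnusPowerSeries A t)
  have htt : t ∈ Icc 0 t := ⟨ht, le_rfl⟩
  have h1 := isBigO_exp_truncEval_sub N hX
  have h2 := isBigO_sub_truncEval_of_hasSum (B := H →L[ℂ] H) N
    (q := PowerSeries.mk fun n ↦ Φ (dysonTerm A n t)) (f := fun z ↦ dysonSum Φ A z t)
    ((summable_dysonBound A t 1).of_nonneg_of_le (fun _ ↦ norm_nonneg _) fun n ↦ by
      simpa using norm_dysonSum_term_le hΦ ht hA (z := 1) (r := 1) (by simp) n htt)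
    fun z _ ↦ by simpa using hasSum_dysonSum hΦ ht hA z htt
  have e (z : ℂ) : truncEval N (truncExp N (PowerSeries.map φ (magnusPowerSeries A t))) z =
      truncEval N (PowerSeries.mk fun n ↦ Φ (dysonTerm A n t)) z := by
    refine Finset.sum_congr rfl fun n hn ↦ ?_
    have h3 : truncExp N (PowerSeries.map φ (magnusPowerSeries A t)) =
        PowerSeries.map φ (truncExp N (magnusPowerSeries A t)) := by
      simp only [truncExp, map_sum, map_rat_smul, map_pow]
    rw [h3, coeff_map, coeff_truncExp_magnusPowerSeries hA
      (Nat.lt_succ_iff.1 (Finset.mem_range.1 hn)) right_mem_uIcc, coeff_mk]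
    rfl
  simp only [e] at h1
  refine (h1.sub h2).congr_left fun z ↦ ?_
  abel

open PowerSeries in
-- The images of the Magnus terms are the Taylor coefficients at 0 of the logarithm of the evolution
-- operator, which is holomorphic on a disc containing `z = 1`.
theorem magnus_hasSum_of_algHom [FiniteDimensional ℂ H] (hΦ : ∀ M, ‖Φ M‖ ≤ ‖M‖) (ht : 0 ≤ t)
    (hA : IntervalIntegrable A volume 0 t) (hpi : ∫ τ in (0 : ℝ)..t, ‖A τ‖ < Real.pi) :
    (Summable fun n ↦ ‖Φ (magnusTerm A n t)‖) ∧
      HasSum (fun n ↦ Φ (magnusTerm A n t)) (segmentLog (dysonSum Φ A 1 t)) ∧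
      NormedSpace.exp (segmentLog (dysonSum Φ A 1 t)) = dysonSum Φ A 1 t := by
  set I := ∫ τ in (0 : ℝ)..t, ‖A τ‖ with hI
  have hI0 : 0 ≤ I := intervalIntegral.integral_nonneg ht fun _ _ ↦ norm_nonneg _
  have htt : t ∈ Icc 0 t := ⟨ht, le_rfl⟩
  -- The strict inequality leaves room for a radius above 1.
  obtain ⟨r, hr1, hr⟩ : ∃ r : ℝ, 1 < r ∧ r * I < Real.pi := by
    have h1 : Tendsto (fun r : ℝ ↦ r * I) (𝓝[>] 1) (𝓝 (1 * I)) :=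
      (tendsto_id.mul_const I).mono_left nhdsWithin_le_nhds
    rw [one_mul] at h1
    obtain ⟨r, h2, h3⟩ := ((h1.eventually (gt_mem_nhds hpi)).and self_mem_nhdsWithin).exists
    exact ⟨r, h3, h2⟩
  set L : ℂ → H →L[ℂ] H := fun z ↦ segmentLog (dysonSum Φ A z t) with hL
  have hunit (z : ℂ) (hz : z ∈ Metric.ball (0 : ℂ) r) (u : ℝ) (hu : u ∈ Icc (0 : ℝ) 1) :
      IsUnit (1 + u • (dysonSum Φ A z t - 1)) := by
    refine isUnit_segment_dysonSum hΦ ht hA (lt_of_le_of_lt ?_ hr) hu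
    exact mul_le_mul_of_nonneg_right (mem_ball_zero_iff.1 hz).le hI0
  have hLd : DifferentiableOn ℂ L (Metric.ball 0 r) :=
    differentiableOn_segmentLog Metric.isOpen_ball
      (differentiable_dysonSum hΦ ht hA htt).differentiableOn hunit
  have hexp (z : ℂ) (hz : z ∈ Metric.ball (0 : ℂ) r) :
      NormedSpace.exp (L z) = dysonSum Φ A z t := exp_segmentLog (hunit z hz)
  obtain ⟨r', h1r', hr'r⟩ := exists_between hr1
  lift r' to NNReal using by linarith
  have h1r : 1 < r' := by exact_mod_cast h1r'
  have hfp := DifferentiableOn.hasFPowerSeriesOnBall (c := (0 : ℂ)) (R := r')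
    (hLd.mono (Metric.closedBall_subset_ball hr'r)) (one_pos.trans h1r)
  set p := cauchyPowerSeries L 0 r'
  set ℓ : (H →L[ℂ] H)⟦X⟧ := PowerSeries.mk fun n ↦ p.coeff n with hℓ
  have hsumN : Summable fun n ↦ ‖coeff n ℓ‖ := by
    have h1 := p.summable_norm_mul_pow (r := 1) (lt_of_lt_of_le (by
      exact_mod_cast h1r) hfp.r_le)
    simpa [hℓ, FormalMultilinearSeries.norm_apply_eq_norm_coef] using h1
  have hsum (z : ℂ) (hz : ‖z‖ ≤ 1) : HasSum (fun n ↦ z ^ n • coeff n ℓ) (L z) := by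
    have h1 := hfp.hasSum (y := z) (by
      rw [Metric.mem_eball, edist_zero_right, enorm_eq_nnnorm, ENNReal.coe_lt_coe,
        ← NNReal.coe_lt_coe]
      exact hz.trans_lt h1r')
    simpa [hℓ] using h1
  have hball : Metric.ball (0 : ℂ) r ∈ 𝓝 (0 : ℂ) := Metric.ball_mem_nhds _ (by linarith)
  have hL0 : Tendsto L (𝓝 0) (𝓝 0) := by
    have h1 := (hLd.continuousOn.continuousAt hball).tendsto
    have h2 : L 0 = 0 := by simp [hL, dysonSum_zero]
    rwa [h2] at h1
  set φ := Φ.toRingHom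
  have hX : X ∣ PowerSeries.map φ (magnusPowerSeries A t) := by
    simpa using map_dvd (PowerSeries.map φ) (X_dvd_magnusPowerSeries A t)
  have hcoef : PowerSeries.map φ (magnusPowerSeries A t) = ℓ := by
    refine coeff_eq_of_isBigO fun N ↦ ?_
    have h1 := isBigO_sub_of_exp ((isBigO_truncEval_id N hX).trans_tendsto tendsto_id) hL0
    have h2 : (fun z ↦ NormedSpace.exp
        (truncEval N (PowerSeries.map φ (magnusPowerSeries A t)) z) - NormedSpace.exp (L z))
        =O[𝓝 0] fun z : ℂ ↦ z ^ (N + 1) := by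
      refine (isBigO_exp_magnus_sub_dysonSum hΦ ht hA N).congr' ?_ EventuallyEq.rfl
      filter_upwards [hball] with z hz
      rw [hexp z hz]
    refine ((h1.trans h2).add (isBigO_sub_truncEval_of_hasSum N hsumN hsum)).congr_left
      fun z ↦ ?_
    abel
  have hc (n : ℕ) : coeff n ℓ = Φ (magnusTerm A n t) := by
    rw [← hcoef, coeff_map, magnusPowerSeries, coeff_mk]
    rfl
  simp only [hc] at hsumN hsum
  refine ⟨hsumN, by simpa using hsum 1 (by simp), hexp 1 (by simpa using hr1)⟩

/-- The Magnus series converges if there is a faithful norm-nonincreasing representation of real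
matrices on a complex Hilbert space. -/
theorem exists_hasSum_magnusTerm_of_ringHom [FiniteDimensional ℂ H]
    (φ : Matrix ι ι ℝ →+* (H →L[ℂ] H)) (hsmul : ∀ (r : ℝ) M, φ (r • M) = (r : ℂ) • φ M)
    (hφ : ∀ M, ‖φ M‖ ≤ ‖M‖) (hinj : Function.Injective φ) (ht : 0 ≤ t)
    (hA : IntervalIntegrable A volume 0 t) (hpi : ∫ τ in (0 : ℝ)..t, ‖A τ‖ < Real.pi)
    {Y : ℝ → Matrix ι ι ℝ} (hY : IsFundamentalSolution A Y t) :
    ∃ Ω : Matrix ι ι ℝ,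
      HasSum (fun n : ℕ => magnusTerm A (n + 1) t) Ω ∧ NormedSpace.exp Ω = Y t := by
  let Φ : Matrix ι ι ℝ →ₐ[ℝ] (H →L[ℂ] H) :=
    { φ with
      commutes' := fun r ↦ by
        change φ _ = _
        rw [Algebra.algebraMap_eq_smul_one, hsmul, map_one, Algebra.algebraMap_eq_smul_one]
        rfl }
  have hΦ : ∀ M, ‖Φ M‖ ≤ ‖M‖ := hφ
  have hΦc : Continuous Φ := (Φ.toLinearMap.mkContinuous 1 (by simpa using hΦ)).continuous
  obtain ⟨h1, h2, h3⟩ := magnus_hasSum_of_algHom hΦ ht hA hpi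
  -- An injective linear map on a finite-dimensional space is bounded below, so absolute convergence
  -- passes back to the real matrices.
  obtain ⟨K, -, hK⟩ := Φ.toLinearMap.exists_antilipschitzWith (LinearMap.ker_eq_bot.2 hinj)
  have hs : Summable fun n ↦ ‖magnusTerm A n t‖ :=
    (h1.mul_left (K : ℝ)).of_nonneg_of_le (fun n ↦ norm_nonneg _) fun n ↦
      ZeroHomClass.bound_of_antilipschitz _ hK (magnusTerm A n t)
  have hs' := hs.of_norm.hasSum
  set Ω := ∑' n, magnusTerm A n t
  have h4 := h2.unique (hs'.map Φ hΦc)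
  refine ⟨Ω, ?_, hinj ?_⟩
  · simpa [magnusTerm] using (hasSum_nat_add_iff' 1).2 hs'
  · let _ : NormedAlgebra ℚ (Matrix ι ι ℝ) := NormedAlgebra.restrictScalars ℚ ℝ _
    let _ : Algebra ℚ (H →L[ℂ] H) := (NormedAlgebra.restrictScalars ℚ ℂ (H →L[ℂ] H)).toAlgebra
    change Φ _ = Φ _
    rw [NormedSpace.map_exp Φ hΦc, ← h4, h3, dysonSum_one_eq hΦ ht hA hY]

end Evolution

end

theorem mainTheorem1 {ι : Type*} [Fintype ι] [DecidableEq ι]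
    (A Y : ℝ → Matrix ι ι ℝ) (t : ℝ) (ht : 0 ≤ t)
    (hA : IntervalIntegrable A MeasureTheory.volume 0 t)
    (hY : IsFundamentalSolution A Y t)
    (hpi : ∫ τ in (0 : ℝ)..t, ‖A τ‖ < Real.pi) :
    ∃ Ω : Matrix ι ι ℝ,
      HasSum (fun n : ℕ => magnusTerm A (n + 1) t) Ω ∧ NormedSpace.exp Ω = Y t := by
  exact exists_hasSum_magnusTerm_of_ringHom (H := EuclideanSpace ℂ ι) complexifyRingHom
    complexifyRingHom_smul norm_complexifyRingHom_le complexifyRingHom_injective ht hA hpi hY
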